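/- Let $p:[0,1]\to\mathbb R$ be a density, i.e. a piecewise continuous function (finitely many discontinuities, finite one-sided limits) that is positive and bounded away from $0$. Let $\alpha\in(0,\pi]$ and $\beta\in[0,\pi)$, and consider the boundary value problem $$-u''=\lambda p(x)u,\quad x\in(0,1),\quad \lambda\in\mathbb C,\qquad u(0)\cos\alpha+u'(0)\sin\alpha=0,\qquad u(1)\cos\beta+u'(1)\sin\beta=0,$$ where a solution is a function $u\in C^1[0,1]$ satisfying the equation at every point of $(0,1)$ at which $p$ is continuous, and $\lambda$ is an eigenvalue if there is a solution $u\not\equiv0$ of the problem. Then all eigenvalues are real, there is a smallest one, $\lambda_0=\lambda_0(p,\alpha,\beta)$, and its sign depends only on $\alpha$ and $\beta$, as follows: 1. $\lambda_0=0$ if and only if $(\alpha,\beta)\in[\pi/4,\pi]\times[0,3\pi/4]$ and $\cos\alpha\cos\beta-\sin(\alpha-\beta)=0$; 2. $\lambda_0>0$ if and only if $(\alpha,\beta)\in(\pi/4,\pi]\times[0,3\pi/4)$ and $\cos\alpha\cos\beta-\sin(\alpha-\beta)<0$; 3. $\lambda_0<0$ if and only if $(\alpha,\beta)$ satisfies neither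 the condition in 1 nor the one in 2. -/

import Mathlib

open Set Filter Topology

namespace VibratingString

/-- `p` is piecewise continuous on `[0, 1]`: it has only finitely many discontinuities, and
finite one-sided limits everywhere (so, in particular, it is bounded). -/
def PiecewiseContinuous (p : ℝ → ℝ) : Prop :=
  {x ∈ Ioo (0 : ℝ) 1 | ¬ ContinuousAt p x}.Finite ∧
  (∀ x ∈ Ico (0 : ℝ) 1, ∃ l : ℝ, Tendsto p (𝓝[>] x) (𝓝 l)) ∧
  (∀ x ∈ Ioc (0 : ℝ) 1, ∃ l : ℝ, Tendsto p (𝓝[<] x) (𝓝 l))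

/-- Density functions on `[0, 1]`: real-valued, piecewise continuous, positive and bounded away
from `0`. Values of `p` outside `[0, 1]` play no role. -/
structure IsDensity (p : ℝ → ℝ) : Prop where
  piecewiseContinuous : PiecewiseContinuous p
  bounded_away : ∃ m : ℝ, 0 < m ∧ ∀ x ∈ Icc (0 : ℝ) 1, m ≤ p x

/-- `u`, with derivative `u'`, is a solution of `-u'' = lam * p * u` on `(0, 1)`: `u` is
continuously differentiable on `[0, 1]` (one-sidedly at the end points), and the equation holds at
each point of `(0, 1)` at which `p` is continuous. -/
structure IsSolution (p : ℝ → ℝ) (lam : ℂ) (u u' : ℝ → ℂ) : Prop where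
  hasDeriv : ∀ x ∈ Icc (0 : ℝ) 1, HasDerivWithinAt u (u' x) (Icc 0 1) x
  continuousOn_deriv : ContinuousOn u' (Icc 0 1)
  equation : ∀ x ∈ Ioo (0 : ℝ) 1, ContinuousAt p x →
    HasDerivAt u' (-(lam * (p x : ℂ) * u x)) x

/-- `lam` is an eigenvalue of `S(p, α, β)`: the equation `-u'' = lam * p * u` has a nontrivial
solution with `u(0) cos α + u'(0) sin α = 0` and `u(1) cos β + u'(1) sin β = 0`. -/
def IsEigenvalue (p : ℝ → ℝ) (α β : ℝ) (lam : ℂ) : Prop :=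
  ∃ u u' : ℝ → ℂ, IsSolution p lam u u' ∧
    u 0 * (Real.cos α : ℂ) + u' 0 * (Real.sin α : ℂ) = 0 ∧
    u 1 * (Real.cos β : ℂ) + u' 1 * (Real.sin β : ℂ) = 0 ∧
    ∃ x ∈ Icc (0 : ℝ) 1, u x ≠ 0

/-- The lowest eigenvalue `λ₀(p, α, β)`, as the infimum of the real eigenvalues. (That it is itself
an eigenvalue, and that all eigenvalues are real, is not built in here.) -/
noncomputable def lowestEigenvalue (p : ℝ → ℝ) (α β : ℝ) : ℝ :=
  sInf {lam : ℝ | IsEigenvalue p α β (lam : ℂ)}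

/-- The boundary parameters lie on the curve `cos α cos β - sin (α - β) = 0` in
`[π/4, π] × [0, 3π/4]`. -/
def OnCurve (α β : ℝ) : Prop :=
  α ∈ Icc (Real.pi / 4) Real.pi ∧ β ∈ Icc 0 (3 * Real.pi / 4) ∧
    Real.cos α * Real.cos β - Real.sin (α - β) = 0

/-- The boundary parameters lie in the part of `(π/4, π] × [0, 3π/4)` on which
`cos α cos β - sin (α - β) < 0`. -/
def InPositiveRegion (α β : ℝ) : Prop :=
  α ∈ Ioc (Real.pi / 4) Real.pi ∧ β ∈ Ico 0 (3 * Real.pi / 4) ∧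
    Real.cos α * Real.cos β - Real.sin (α - β) < 0

end VibratingString

/-! Shooting from `0`: let `y l` solve the equation with Cauchy data `(sin α, -cos α)`, and let `F l
= y l 1 cos β + y' l 1 sin β`. The real eigenvalues are the zeros of the continuous function `F`
(`isEigenvalue_iff`), and Lagrange's identity excludes non-real ones. A Riccati comparison gives `F
> 0` near `-∞` (`exists_forall_le_pos`), so any `l` with `F l ≤ 0` has an eigenvalue at or below it
(`exists_root_le`). The least `k` for which `y k` vanishes somewhere in `(0, 1]` is such an `l`.

The sign is independent of `p` because at `l = 0` the density drops out: `y 0 x = sin α - x cos α`,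
and `F 0` is minus the expression in the theorem. If `F 0 < 0`, there is a negative eigenvalue. If
`sin α < cos α`, then `y 0 1 < 0`, hence `k < 0` and again an eigenvalue is negative. Otherwise the
line is positive on `(0, 1)` and `F 0 ≥ 0`; Sturm comparison with it gives `F > 0` on the negative
axis (`characteristicFunction_pos_of_neg`), and the sign of `F 0` decides. -/

namespace VibratingString

/-! ### Monotonicity with finitely many exceptional points -/

section Monotonicity

/-- Solutions have a second derivative only where `p` is continuous. Continuity of `f` lets the
interval be split at each exceptional point, by induction on `s`. -/
theorem le_of_hasDerivAt_nonneg_off_finite {f f' : ℝ → ℝ} {s : Set ℝ} (hs : s.Finite) :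
    ∀ {a b : ℝ}, a ≤ b → ContinuousOn f (Icc a b) →
      (∀ x ∈ Ioo a b, x ∉ s → HasDerivAt f (f' x) x ∧ 0 ≤ f' x) → f a ≤ f b := by
  induction s, hs using Set.Finite.induction_on with
  | empty =>
    intro a b hab hf hd
    refine monotoneOn_of_hasDerivWithinAt_nonneg (convex_Icc a b) hf (f' := f') ?_ ?_
      (left_mem_Icc.2 hab) (right_mem_Icc.2 hab) hab
    · intro x hx
      rw [interior_Icc] at hx
      exact (hd x hx (notMem_empty x)).1.hasDerivWithinAt
    · intro x hx
      rw [interior_Icc] at hx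
      exact (hd x hx (notMem_empty x)).2
  | @insert c t hc ht ih =>
    intro a b hab hf hd
    by_cases hcm : c ∈ Ioo a b
    · have h1 := ih hcm.1.le (hf.mono (Icc_subset_Icc_right hcm.2.le)) (fun x hx hxt =>
        hd x ⟨hx.1, hx.2.trans hcm.2⟩ (by
          rintro (rfl | h)
          · exact lt_irrefl _ hx.2
          · exact hxt h))
      have h2 := ih hcm.2.le (hf.mono (Icc_subset_Icc_left hcm.1.le)) (fun x hx hxt =>
        hd x ⟨hcm.1.trans hx.1, hx.2⟩ (by
          rintro (rfl | h)
          · exact lt_irrefl _ hx.1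
          · exact hxt h))
      exact h1.trans h2
    · exact ih hab hf (fun x hx hxt => hd x hx (by
        rintro (rfl | h)
        · exact hcm hx
        · exact hxt h))

theorem monotoneOn_of_hasDerivAt_nonneg_off_finite {f f' : ℝ → ℝ} {s : Set ℝ} (hs : s.Finite)
    {a b : ℝ} (hf : ContinuousOn f (Icc a b))
    (hd : ∀ x ∈ Ioo a b, x ∉ s → HasDerivAt f (f' x) x ∧ 0 ≤ f' x) : MonotoneOn f (Icc a b) := by
  intro x hx y hy hxy
  exact le_of_hasDerivAt_nonneg_off_finite hs hxy (hf.mono (Icc_subset_Icc hx.1 hy.2))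
    (fun t ht => hd t ⟨hx.1.trans_lt ht.1, ht.2.trans_le hy.2⟩)

theorem antitoneOn_of_hasDerivAt_nonpos_off_finite {f f' : ℝ → ℝ} {s : Set ℝ} (hs : s.Finite)
    {a b : ℝ} (hf : ContinuousOn f (Icc a b))
    (hd : ∀ x ∈ Ioo a b, x ∉ s → HasDerivAt f (f' x) x ∧ f' x ≤ 0) : AntitoneOn f (Icc a b) := by
  have h := monotoneOn_of_hasDerivAt_nonneg_off_finite (f := fun x => -f x) (f' := fun x => -f' x)
    hs hf.neg (fun x hx hxs => ⟨(hd x hx hxs).1.neg, neg_nonneg.2 (hd x hx hxs).2⟩)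
  exact fun x hx y hy hxy => neg_le_neg_iff.1 (h hx hy hxy)

theorem deriv_eq_zero_of_monotoneOn_of_eq {f : ℝ → ℝ} {a b : ℝ} (hf : MonotoneOn f (Icc a b))
    (hab : f b ≤ f a) {x d : ℝ} (hx : x ∈ Ioo a b) (hd : HasDerivAt f d x) : d = 0 := by
  have hc : ∀ t ∈ Icc a b, f t = f a := fun t ht =>
    le_antisymm ((hf ht (right_mem_Icc.2 (hx.1.trans hx.2).le) ht.2).trans hab)
      (hf (left_mem_Icc.2 (hx.1.trans hx.2).le) ht ht.1)
  have h2 : f =ᶠ[𝓝 x] fun _ => f a := by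
    filter_upwards [Icc_mem_nhds hx.1 hx.2] with t ht using hc t ht
  exact (hd.congr_of_eventuallyEq h2.symm).unique (hasDerivAt_const x (f a))

theorem eqOn_zero_of_off_finite {u : ℝ → ℂ} {s : Set ℝ} (hs : s.Finite)
    (hu : ContinuousOn u (Icc 0 1)) (h : ∀ x ∈ Ioo (0 : ℝ) 1, x ∉ s → u x = 0) :
    ∀ x ∈ Icc (0 : ℝ) 1, u x = 0 := by
  have : EqOn u (fun _ => 0) (Icc 0 1) := by
    refine MeasureTheory.Measure.eqOn_Icc_of_ae_eq MeasureTheory.volume zero_ne_one ?_ hu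
      continuousOn_const
    rw [← MeasureTheory.restrict_Ioo_eq_restrict_Icc]
    filter_upwards [MeasureTheory.ae_restrict_mem measurableSet_Ioo,
      MeasureTheory.ae_restrict_of_ae (hs.countable.ae_notMem MeasureTheory.volume)] with x hx hxs
    exact h x hx hxs
  exact this

theorem lt_of_hasDerivAt_pos_off_finite {f f' : ℝ → ℝ} {s : Set ℝ} (hs : s.Finite) {a b : ℝ}
    (hab : a < b) (hf : ContinuousOn f (Icc a b))
    (hd : ∀ x ∈ Ioo a b, x ∉ s → HasDerivAt f (f' x) x ∧ 0 < f' x) : f a < f b := by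
  by_contra hlt
  obtain ⟨x, hx, hxs⟩ := ((Ioo_infinite hab).sdiff hs).nonempty
  have hm := monotoneOn_of_hasDerivAt_nonneg_off_finite hs hf
    (fun x hx hxs => ⟨(hd x hx hxs).1, (hd x hx hxs).2.le⟩)
  exact (hd x hx hxs).2.ne'
    (deriv_eq_zero_of_monotoneOn_of_eq hm (not_lt.1 hlt) hx (hd x hx hxs).1)

end Monotonicity

/-! ### Boundedness and integrability of densities -/

section Density

variable {p : ℝ → ℝ}

theorem IsDensity.exists_bound (hp : IsDensity p) :
    ∃ M : ℝ, 0 < M ∧ ∀ x ∈ Icc (0 : ℝ) 1, |p x| ≤ M := by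
  have key : ∃ M : ℝ, ∀ x ∈ Icc (0 : ℝ) 1, |p x| ≤ M := by
    refine isCompact_Icc.induction_on (p := fun t => ∃ M : ℝ, ∀ x ∈ t, |p x| ≤ M)
      ⟨0, by simp⟩ (fun s t hst ⟨M, hM⟩ => ⟨M, fun x hx => hM x (hst hx)⟩) ?_ ?_
    · rintro s t ⟨M, hM⟩ ⟨N, hN⟩
      refine ⟨max M N, ?_⟩
      rintro x (hx | hx)
      · exact (hM x hx).trans (le_max_left _ _)
      · exact (hN x hx).trans (le_max_right _ _)
    · intro x hx
      have bd : ∀ (l : Filter ℝ), (∃ c, Tendsto p l (𝓝 c)) → ∃ M, ∀ᶠ t in l, |p t| ≤ M := by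
        rintro l ⟨c, hc⟩
        exact ⟨|c| + 1, (hc.abs.eventually_lt_const (lt_add_one |c|)).mono fun t h => h.le⟩
      have hr : ∃ M, ∀ᶠ t in 𝓝[>] x, t ∈ Icc (0 : ℝ) 1 → |p t| ≤ M := by
        rcases hx.2.lt_or_eq with h | h
        · obtain ⟨M, hM⟩ := bd _ (hp.piecewiseContinuous.2.1 x ⟨hx.1, h⟩)
          exact ⟨M, hM.mono fun t h _ => h⟩
        · refine ⟨0, eventually_nhdsWithin_of_forall fun t ht h1 => ?_⟩
          exact absurd h1.2 (not_le.2 (h ▸ ht))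
      have hl : ∃ M, ∀ᶠ t in 𝓝[<] x, t ∈ Icc (0 : ℝ) 1 → |p t| ≤ M := by
        rcases hx.1.lt_or_eq with h | h
        · obtain ⟨M, hM⟩ := bd _ (hp.piecewiseContinuous.2.2 x ⟨h, hx.2⟩)
          exact ⟨M, hM.mono fun t h _ => h⟩
        · refine ⟨0, eventually_nhdsWithin_of_forall fun t ht h1 => ?_⟩
          exact absurd h1.1 (not_le.2 (h ▸ ht))
      obtain ⟨M, hM⟩ := hr
      obtain ⟨N, hN⟩ := hl
      rw [eventually_nhdsWithin_iff] at hM hN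
      -- The one-sided limits say nothing about the value at `x`, so `|p x|` enters the local bound
      -- separately.
      refine ⟨{t | t ∈ Icc (0 : ℝ) 1 → |p t| ≤ max (max M N) |p x|} ∩ Icc 0 1, ?_,
        ⟨_, fun t ht => ht.1 ht.2⟩⟩
      refine inter_mem (mem_nhdsWithin_of_mem_nhds ?_) self_mem_nhdsWithin
      filter_upwards [hM, hN] with t h1 h2 ht
      rcases lt_trichotomy t x with h | h | h
      · exact (h2 h ht).trans ((le_max_right _ _).trans (le_max_left _ _))
      · rw [h]; exact le_max_right _ _
      · exact (h1 h ht).trans ((le_max_left _ _).trans (le_max_left _ _))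
  obtain ⟨M, hM⟩ := key
  exact ⟨max M 1, by positivity, fun x hx => (hM x hx).trans (le_max_left _ _)⟩

theorem IsDensity.finite_discontinuities (hp : IsDensity p) :
    {x ∈ Ioo (0 : ℝ) 1 | ¬ ContinuousAt p x}.Finite := hp.piecewiseContinuous.1

theorem continuousAt_of_notMem_discontinuities {x : ℝ} (hx : x ∈ Ioo (0 : ℝ) 1)
    (h : x ∉ {x ∈ Ioo (0 : ℝ) 1 | ¬ ContinuousAt p x}) : ContinuousAt p x := by
  by_contra hc
  exact h ⟨hx, hc⟩

theorem IsDensity.pos (hp : IsDensity p) {x : ℝ} (hx : x ∈ Icc (0 : ℝ) 1) : 0 < p x := by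
  obtain ⟨m, hm, h⟩ := hp.bounded_away
  exact hm.trans_le (h x hx)

theorem IsDensity.integrableOn (hp : IsDensity p) :
    MeasureTheory.IntegrableOn p (Icc 0 1) := by
  obtain ⟨M, -, hM⟩ := hp.exists_bound
  set D := {x ∈ Ioo (0 : ℝ) 1 | ¬ ContinuousAt p x} with hD
  have hfin : D.Finite := hp.finite_discontinuities
  have hae : (Ioo (0 : ℝ) 1 \ D : Set ℝ) =ᵐ[MeasureTheory.volume] Icc (0 : ℝ) 1 :=
    (MeasureTheory.sdiff_null_ae_eq_self (hfin.measure_zero _)).trans MeasureTheory.Ioo_ae_eq_Icc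
  rw [← MeasureTheory.integrableOn_congr_set_ae hae]
  have hms : MeasurableSet (Ioo (0 : ℝ) 1 \ D) := measurableSet_Ioo.diff hfin.measurableSet
  have : MeasureTheory.IsFiniteMeasure (MeasureTheory.volume.restrict (Ioo (0 : ℝ) 1 \ D)) :=
    ⟨by
      rw [MeasureTheory.Measure.restrict_apply_univ]
      exact (MeasureTheory.measure_mono sdiff_subset).trans_lt measure_Ioo_lt_top⟩
  refine MeasureTheory.Integrable.of_bound (C := M) ?_ ?_
  · refine ContinuousOn.aestronglyMeasurable (fun x hx => ?_) hms
    exact (continuousAt_of_notMem_discontinuities hx.1 hx.2).continuousWithinAt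
  · filter_upwards [MeasureTheory.ae_restrict_mem hms] with x hx
    exact hM x (Ioo_subset_Icc_self hx.1)

end Density

/-! ### Uniqueness and reality of eigenvalues -/

section Solutions

variable {p : ℝ → ℝ} {lam : ℂ} {u u' : ℝ → ℂ}

theorem IsSolution.continuousOn (h : IsSolution p lam u u') : ContinuousOn u (Icc 0 1) :=
  fun x hx => (h.hasDeriv x hx).continuousWithinAt

theorem IsSolution.hasDerivAt (h : IsSolution p lam u u') {x : ℝ} (hx : x ∈ Ioo (0 : ℝ) 1) :
    HasDerivAt u (u' x) x :=
  (h.hasDeriv x (Ioo_subset_Icc_self hx)).hasDerivAt (Icc_mem_nhds hx.1 hx.2)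

theorem abs_inner_energy_le {a b : ℂ} {l : ℂ} {q M : ℝ} (hq : |q| ≤ M) :
    |2 * inner ℝ a b + 2 * inner ℝ b (-(l * (q : ℂ) * a))| ≤
      (1 + ‖l‖ * M) * (‖a‖ ^ 2 + ‖b‖ ^ 2) := by
  have h1 : |inner ℝ a b| ≤ ‖a‖ * ‖b‖ := abs_real_inner_le_norm a b
  have h2 : |inner ℝ b (-(l * (q : ℂ) * a))| ≤ ‖b‖ * (‖l‖ * M * ‖a‖) := by
    refine (abs_real_inner_le_norm _ _).trans ?_
    rw [norm_neg, norm_mul, norm_mul, Complex.norm_real, Real.norm_eq_abs]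
    gcongr
  have h3 : 0 ≤ ‖l‖ * M := mul_nonneg (norm_nonneg _) ((abs_nonneg q).trans hq)
  calc _ ≤ |2 * inner ℝ a b| + |2 * inner ℝ b (-(l * (q : ℂ) * a))| := abs_add_le _ _
    _ = 2 * |inner ℝ a b| + 2 * |inner ℝ b (-(l * (q : ℂ) * a))| := by
      rw [abs_mul, abs_mul, abs_two]
    _ ≤ 2 * (‖a‖ * ‖b‖) + 2 * (‖b‖ * (‖l‖ * M * ‖a‖)) := by gcongr
    _ = (1 + ‖l‖ * M) * (2 * ‖a‖ * ‖b‖) := by ring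
    _ ≤ _ := by
      gcongr
      exact two_mul_le_add_sq _ _

/-- A solution with vanishing Cauchy data at one point vanishes identically. -/
theorem IsSolution.eq_zero (hp : IsDensity p) (h : IsSolution p lam u u') {x₀ : ℝ}
    (hx₀ : x₀ ∈ Icc (0 : ℝ) 1) (h0 : u x₀ = 0) (h0' : u' x₀ = 0) :
    ∀ x ∈ Icc (0 : ℝ) 1, u x = 0 ∧ u' x = 0 := by
  obtain ⟨M, hM0, hM⟩ := hp.exists_bound
  set C := 1 + ‖lam‖ * M
  set E : ℝ → ℝ := fun x => ‖u x‖ ^ 2 + ‖u' x‖ ^ 2 with hE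
  set E' : ℝ → ℝ := fun x => 2 * inner ℝ (u x) (u' x) +
    2 * inner ℝ (u' x) (-(lam * (p x : ℂ) * u x)) with hE'
  have hEc : ContinuousOn E (Icc 0 1) :=
    (h.continuousOn.norm.pow 2).add (h.continuousOn_deriv.norm.pow 2)
  have hEd : ∀ x ∈ Ioo (0 : ℝ) 1, x ∉ {x ∈ Ioo (0 : ℝ) 1 | ¬ ContinuousAt p x} →
      HasDerivAt E (E' x) x ∧ |E' x| ≤ C * E x := fun x hx hxs =>
    ⟨(h.hasDerivAt hx).norm_sq.add
      (h.equation x hx (continuousAt_of_notMem_discontinuities hx hxs)).norm_sq,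
      abs_inner_energy_le (hM x (Ioo_subset_Icc_self hx))⟩
  have hexp : ∀ k x : ℝ, HasDerivAt (fun x => Real.exp (k * x)) (Real.exp (k * x) * k) x :=
    fun k x => by simpa using ((hasDerivAt_id x).const_mul k).exp
  have hexpc : ∀ k : ℝ, ContinuousOn (fun x => Real.exp (k * x)) (Icc (0 : ℝ) 1) := fun k =>
    fun x _ => (hexp k x).continuousAt.continuousWithinAt
  -- Grönwall in both directions: this weight carries the zero of `E` to the left of `x₀`, the
  -- opposite one to the right.
  have hmono : MonotoneOn (fun x => E x * Real.exp (C * x)) (Icc 0 1) := by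
    refine monotoneOn_of_hasDerivAt_nonneg_off_finite hp.finite_discontinuities
      (hEc.mul (hexpc C)) (fun x hx hxs => ⟨(hEd x hx hxs).1.mul (hexp C x), ?_⟩)
    have := (abs_le.1 (hEd x hx hxs).2).1
    have he := Real.exp_pos (C * x)
    nlinarith
  have hanti : AntitoneOn (fun x => E x * Real.exp (-C * x)) (Icc 0 1) := by
    refine antitoneOn_of_hasDerivAt_nonpos_off_finite hp.finite_discontinuities
      (hEc.mul (hexpc (-C))) (fun x hx hxs => ⟨(hEd x hx hxs).1.mul (hexp (-C) x), ?_⟩)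
    have := (abs_le.1 (hEd x hx hxs).2).2
    have he := Real.exp_pos (-C * x)
    nlinarith
  have hE0 : E x₀ = 0 := by simp [hE, h0, h0']
  intro x hx
  have hle : E x ≤ 0 := by
    rcases le_total x x₀ with hxx | hxx
    · have := hmono hx hx₀ hxx
      simp only [hE0, zero_mul] at this
      exact nonpos_of_mul_nonpos_left this (Real.exp_pos _)
    · have := hanti hx₀ hx hxx
      simp only [hE0, zero_mul] at this
      exact nonpos_of_mul_nonpos_left this (Real.exp_pos _)
  have h1 : 0 ≤ ‖u x‖ ^ 2 := by positivity
  have h2 : 0 ≤ ‖u' x‖ ^ 2 := by positivity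
  have hle' : ‖u x‖ ^ 2 + ‖u' x‖ ^ 2 ≤ 0 := hle
  constructor
  · exact norm_eq_zero.1 (pow_eq_zero_iff two_ne_zero |>.1 (by linarith))
  · exact norm_eq_zero.1 (pow_eq_zero_iff two_ne_zero |>.1 (by linarith))

/-- The condition makes `(a, b)` a complex multiple of the real vector `(sin θ, -cos θ)`, so `b`
times the conjugate of `a` is real. -/
theorem im_mul_conj_eq_zero_of_boundary {a b : ℂ} {θ : ℝ}
    (h : a * (Real.cos θ : ℂ) + b * (Real.sin θ : ℂ) = 0) : b.im * a.re - b.re * a.im = 0 := by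
  have hre := congrArg Complex.re h
  have him := congrArg Complex.im h
  simp only [Complex.add_re, Complex.add_im, Complex.re_mul_ofReal, Complex.im_mul_ofReal,
    Complex.zero_re, Complex.zero_im] at hre him
  have := Real.sin_sq_add_cos_sq θ
  linear_combination (b.im * a.re - b.re * a.im) * (-this) +
    Real.cos θ * (b.im * hre - b.re * him) + Real.sin θ * (a.re * him - a.im * hre)

theorem IsEigenvalue.im_eq_zero (hp : IsDensity p) {α β : ℝ} (h : IsEigenvalue p α β lam) :
    lam.im = 0 := by
  obtain ⟨u, u', hu, h0, h1, x₁, hx₁, hne⟩ := h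
  by_contra him
  -- Lagrange's identity. The factor `lam.im` makes the derivative a square times `p ‖u‖²`,
  -- nonnegative for either sign of `lam.im`; `G` vanishes at both ends.
  set G : ℝ → ℝ := fun x => lam.im * ((u' x).re * (u x).im - (u' x).im * (u x).re) with hG
  have hre : ∀ {v : ℝ → ℂ} {w : ℂ} {x : ℝ}, HasDerivAt v w x →
      HasDerivAt (fun x => (v x).re) w.re x := fun {v w x} hv =>
    Complex.reCLM.hasFDerivAt.comp_hasDerivAt x hv
  have himd : ∀ {v : ℝ → ℂ} {w : ℂ} {x : ℝ}, HasDerivAt v w x →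
      HasDerivAt (fun x => (v x).im) w.im x := fun {v w x} hv =>
    Complex.imCLM.hasFDerivAt.comp_hasDerivAt x hv
  have hGd : ∀ x ∈ Ioo (0 : ℝ) 1, x ∉ {x ∈ Ioo (0 : ℝ) 1 | ¬ ContinuousAt p x} →
      HasDerivAt G (lam.im ^ 2 * p x * ‖u x‖ ^ 2) x := by
    intro x hx hxs
    have d1 := hu.hasDerivAt hx
    have d2 := hu.equation x hx (continuousAt_of_notMem_discontinuities hx hxs)
    refine ((((hre d2).mul (himd d1)).sub ((himd d2).mul (hre d1))).const_mul lam.im).congr_deriv ?_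
    rw [← Complex.normSq_eq_norm_sq, Complex.normSq_apply]
    simp only [Complex.neg_re, Complex.neg_im, Complex.mul_re, Complex.mul_im, Complex.ofReal_re,
      Complex.ofReal_im]
    ring
  have hGc : ContinuousOn G (Icc 0 1) := by
    have c1 := hu.continuousOn
    have c2 := hu.continuousOn_deriv
    have r1 := Complex.continuous_re.comp_continuousOn c1
    have i1 := Complex.continuous_im.comp_continuousOn c1
    have r2 := Complex.continuous_re.comp_continuousOn c2
    have i2 := Complex.continuous_im.comp_continuousOn c2
    exact continuousOn_const.mul ((r2.mul i1).sub (i2.mul r1))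
  have hGm : MonotoneOn G (Icc 0 1) :=
    monotoneOn_of_hasDerivAt_nonneg_off_finite hp.finite_discontinuities hGc
      (fun x hx hxs => ⟨hGd x hx hxs, by
        have := hp.pos (Ioo_subset_Icc_self hx)
        positivity⟩)
  have hG0 : G 0 = 0 := by
    have := im_mul_conj_eq_zero_of_boundary h0
    simp only [hG]; linear_combination -lam.im * this
  have hG1 : G 1 = 0 := by
    have := im_mul_conj_eq_zero_of_boundary h1
    simp only [hG]; linear_combination -lam.im * this
  refine hne (eqOn_zero_of_off_finite hp.finite_discontinuities hu.continuousOn ?_ x₁ hx₁)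
  intro x hx hxs
  have hz := deriv_eq_zero_of_monotoneOn_of_eq hGm (by rw [hG0, hG1]) hx (hGd x hx hxs)
  have := hp.pos (Ioo_subset_Icc_self hx)
  simpa [him, this.ne'] using hz

end Solutions

end VibratingString

namespace VibratingString

/-! ### Volterra integral operators -/

section Volterra

open MeasureTheory

variable {q : ℝ → ℝ} {M : ℝ}

theorem intervalIntegrable_mul_iccExtend (hq : IntegrableOn q (Icc 0 1)) (f : C(Icc (0 : ℝ) 1, ℝ))
    {x : ℝ} (hx : x ∈ Icc (0 : ℝ) 1) :
    IntervalIntegrable (fun t => q t * IccExtend (zero_le_one' ℝ) f t) volume 0 x := by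
  refine IntervalIntegrable.mul_continuousOn ?_ f.continuous.Icc_extend'.continuousOn
  refine (hq.mono_set ?_).intervalIntegrable
  rw [uIcc_of_le hx.1]
  exact Icc_subset_Icc_right hx.2

theorem continuousOn_integral_mul_iccExtend (hq : IntegrableOn q (Icc 0 1))
    (f : C(Icc (0 : ℝ) 1, ℝ)) :
    ContinuousOn (fun x => ∫ t in (0 : ℝ)..x, q t * IccExtend (zero_le_one' ℝ) f t)
      (Icc 0 1) := by
  have h := intervalIntegral.continuousOn_primitive_interval'
    (intervalIntegrable_mul_iccExtend hq f (right_mem_Icc.2 zero_le_one)) left_mem_uIcc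
  rwa [uIcc_of_le zero_le_one] at h

theorem abs_integral_mul_iccExtend_le (hM0 : 0 ≤ M)
    (hM : ∀ x ∈ Icc (0 : ℝ) 1, |q x| ≤ M) {f : C(Icc (0 : ℝ) 1, ℝ)} {C : ℝ} {n : ℕ}
    (hf : ∀ x, |f x| ≤ C * ((x : ℝ) ^ n / n.factorial)) {x : ℝ} (hx : x ∈ Icc (0 : ℝ) 1) :
    |∫ t in (0 : ℝ)..x, q t * IccExtend (zero_le_one' ℝ) f t| ≤
      M * C * (x ^ (n + 1) / (n + 1).factorial) := by
  have h1 : ‖∫ t in (0 : ℝ)..x, q t * IccExtend (zero_le_one' ℝ) f t‖ ≤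
      ∫ t in (0 : ℝ)..x, M * C / n.factorial * t ^ n := by
    refine intervalIntegral.norm_integral_le_of_norm_le hx.1 ?_
      (by apply Continuous.intervalIntegrable; fun_prop)
    refine Eventually.of_forall fun t ht => ?_
    have htI : t ∈ Icc (0 : ℝ) 1 := ⟨ht.1.le, ht.2.trans hx.2⟩
    rw [norm_mul, IccExtend_of_mem _ _ htI, Real.norm_eq_abs, Real.norm_eq_abs]
    calc |q t| * |f ⟨t, htI⟩| ≤ M * (C * (t ^ n / n.factorial)) :=
          mul_le_mul (hM t htI) (hf ⟨t, htI⟩) (abs_nonneg _) hM0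
      _ = _ := by ring
  rw [Real.norm_eq_abs, intervalIntegral.integral_const_mul, integral_pow] at h1
  refine h1.trans_eq ?_
  rw [Nat.factorial_succ]
  push_cast
  have : (n.factorial : ℝ) ≠ 0 := by positivity
  field_simp
  simp

theorem exists_primitive_operator (hq : IntegrableOn q (Icc 0 1)) (hM0 : 0 ≤ M)
    (hM : ∀ x ∈ Icc (0 : ℝ) 1, |q x| ≤ M) :
    ∃ J : C(Icc (0 : ℝ) 1, ℝ) →L[ℝ] C(Icc (0 : ℝ) 1, ℝ),
      ∀ f x, J f x = ∫ t in (0 : ℝ)..x, q t * IccExtend (zero_le_one' ℝ) f t := by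
  let J₀ : C(Icc (0 : ℝ) 1, ℝ) →ₗ[ℝ] C(Icc (0 : ℝ) 1, ℝ) :=
    { toFun := fun f => ⟨fun x => ∫ t in (0 : ℝ)..x, q t * IccExtend (zero_le_one' ℝ) f t,
        (continuousOn_integral_mul_iccExtend hq f).comp_continuous continuous_subtype_val
          fun x => x.2⟩
      map_add' := fun f g => by
        ext x
        simp only [ContinuousMap.coe_mk, ContinuousMap.add_apply]
        rw [← intervalIntegral.integral_add (intervalIntegrable_mul_iccExtend hq f x.2)
          (intervalIntegrable_mul_iccExtend hq g x.2)]
        simp only [IccExtend, Function.comp_apply, ContinuousMap.add_apply, mul_add]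
      map_smul' := fun c f => by
        ext x
        simp only [ContinuousMap.coe_mk, ContinuousMap.smul_apply, RingHom.id_apply, smul_eq_mul]
        rw [← intervalIntegral.integral_const_mul]
        simp only [IccExtend, Function.comp_apply, ContinuousMap.smul_apply, smul_eq_mul]
        congr 1
        ext t
        ring }
  refine ⟨J₀.mkContinuous M fun f => ?_, fun f x => rfl⟩
  rw [ContinuousMap.norm_le _ (by positivity)]
  intro x
  have h := abs_integral_mul_iccExtend_le hM0 hM (f := f) (C := ‖f‖) (n := 0)
    (fun x => by simpa using f.norm_coe_le_norm x) x.2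
  refine h.trans ?_
  simp only [zero_add, pow_one, Nat.factorial_one, Nat.cast_one, div_one]
  exact mul_le_of_le_one_right (by positivity) x.2.2

/-- `1 - a` is a commuting factor of the unit `1 - a ^ n`. -/
theorem isUnit_one_sub_of_norm_pow_lt_one {R : Type*} [NormedRing R] [CompleteSpace R] {a : R}
    {n : ℕ} (h : ‖a ^ n‖ < 1) : IsUnit (1 - a) := by
  have hu : IsUnit (1 - a ^ n) := (Units.oneSub (a ^ n) h).isUnit
  have hc : Commute (1 - a) (∑ i ∈ Finset.range n, a ^ i) :=
    ((Commute.one_left _).sub_left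
      (Commute.sum_right _ _ _ fun i _ => (Commute.refl a).pow_right i))
  rw [← mul_neg_geom_sum a n, hc.isUnit_mul_iff] at hu
  exact hu.1

theorem isUnit_one_add_smul_of_norm_pow_le {R : Type*} [NormedRing R] [NormedAlgebra ℝ R]
    [CompleteSpace R] {K : R} (hK : ∀ n : ℕ, ‖K ^ n‖ ≤ M ^ n / n.factorial) (l : ℝ) :
    IsUnit (1 + l • K) := by
  obtain ⟨n, hn⟩ := ((FloorSemiring.tendsto_pow_div_factorial_atTop (|l| * M)).eventually_lt_const
    zero_lt_one).exists
  have h : ‖((-l) • K) ^ n‖ < 1 := by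
    rw [smul_pow, norm_smul, norm_pow, norm_neg, Real.norm_eq_abs]
    calc |l| ^ n * ‖K ^ n‖ ≤ |l| ^ n * (M ^ n / n.factorial) := by
          gcongr; exact hK n
      _ = (|l| * M) ^ n / n.factorial := by rw [mul_pow]; ring
      _ < 1 := hn
  simpa using isUnit_one_sub_of_norm_pow_lt_one h

/-- Each integration raises the power of `x` and the factorial by one, so powers of `J₁ * J` decay
faster than geometrically and `l` need not be small. The bound with `n!` in place of `(2n)!`
suffices. -/
theorem isUnit_one_add_smul_volterra {J J₁ : C(Icc (0 : ℝ) 1, ℝ) →L[ℝ] C(Icc (0 : ℝ) 1, ℝ)}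
    (hM0 : 0 ≤ M) (hM : ∀ x ∈ Icc (0 : ℝ) 1, |q x| ≤ M)
    (hJ : ∀ f x, J f x = ∫ t in (0 : ℝ)..x, q t * IccExtend (zero_le_one' ℝ) f t)
    (hJ₁ : ∀ f x, J₁ f x = ∫ t in (0 : ℝ)..x, 1 * IccExtend (zero_le_one' ℝ) f t) (l : ℝ) :
    IsUnit (1 + l • (J₁ * J)) := by
  have hiter : ∀ n : ℕ, ∀ f x, |((J₁ * J) ^ n) f x| ≤
      M ^ n * ‖f‖ * ((x : ℝ) ^ (2 * n) / (2 * n).factorial) := by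
    intro n
    induction n with
    | zero => intro f x; simpa using f.norm_coe_le_norm x
    | succ n ih =>
      intro f x
      rw [pow_succ']
      change |J₁ (J (((J₁ * J) ^ n) f)) x| ≤ _
      rw [hJ₁]
      have h1 : ∀ x, |J (((J₁ * J) ^ n) f) x| ≤
          M * (M ^ n * ‖f‖) * ((x : ℝ) ^ (2 * n + 1) / (2 * n + 1).factorial) := fun x => by
        rw [hJ]
        exact abs_integral_mul_iccExtend_le hM0 hM (ih f) x.2
      refine (abs_integral_mul_iccExtend_le (M := 1) zero_le_one (by simp) h1 x.2).trans_eq ?_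
      rw [show 2 * (n + 1) = 2 * n + 1 + 1 by ring]
      ring
  have hnorm : ∀ n : ℕ, ‖(J₁ * J) ^ n‖ ≤ M ^ n / n.factorial := by
    intro n
    refine ContinuousLinearMap.opNorm_le_bound _ (by positivity) fun f => ?_
    rw [ContinuousMap.norm_le _ (by positivity)]
    intro x
    refine (hiter n f x).trans ?_
    have h1 : (x : ℝ) ^ (2 * n) ≤ 1 := pow_le_one₀ x.2.1 x.2.2
    have h2 : (n.factorial : ℝ) ≤ (2 * n).factorial := by
      exact_mod_cast Nat.factorial_le (by omega)
    have h3 : (0 : ℝ) < n.factorial := by positivity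
    calc M ^ n * ‖f‖ * ((x : ℝ) ^ (2 * n) / (2 * n).factorial)
        ≤ M ^ n * ‖f‖ * (1 / n.factorial) := by gcongr
      _ = _ := by ring
  exact isUnit_one_add_smul_of_norm_pow_le
    (R := C(Icc (0 : ℝ) 1, ℝ) →L[ℝ] C(Icc (0 : ℝ) 1, ℝ)) hnorm l

end Volterra

/-! ### The initial value problem with a parameter -/

section RealSolutions

open MeasureTheory

/-- A real solution of `-y'' = l * p * y` on `[0, 1]`, with derivative `y'`. -/
structure IsRealSolution (p : ℝ → ℝ) (l : ℝ) (y y' : ℝ → ℝ) : Prop where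
  hasDeriv : ∀ x ∈ Icc (0 : ℝ) 1, HasDerivWithinAt y (y' x) (Icc 0 1) x
  continuousOn_deriv : ContinuousOn y' (Icc 0 1)
  equation : ∀ x ∈ Ioo (0 : ℝ) 1, ContinuousAt p x → HasDerivAt y' (-(l * p x * y x)) x

/-- The initial value problem has a solution, jointly continuous in the spectral parameter and the
space variable. -/
theorem IsDensity.exists_solution_family {p : ℝ → ℝ} (hp : IsDensity p) (a b : ℝ) :
    ∃ y y' : ℝ → ℝ → ℝ, Continuous (fun z : ℝ × ℝ => y z.1 z.2) ∧
      Continuous (fun z : ℝ × ℝ => y' z.1 z.2) ∧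
      ∀ l, IsRealSolution p l (y l) (y' l) ∧ y l 0 = a ∧ y' l 0 = b := by
  obtain ⟨M, hM0, hM⟩ := hp.exists_bound
  obtain ⟨J, hJ⟩ := exists_primitive_operator hp.integrableOn hM0.le hM
  obtain ⟨J₁, hJ₁⟩ := exists_primitive_operator (q := fun _ => 1) (M := 1)
    (integrableOn_const (by simp)) zero_le_one (by simp)
  have hunit := isUnit_one_add_smul_volterra hM0.le hM hJ hJ₁
  let B : C(Icc (0 : ℝ) 1, ℝ) := ContinuousMap.const _ b
  let A : C(Icc (0 : ℝ) 1, ℝ) := ContinuousMap.const _ a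
  -- Eliminating `Y'` from `Y = A + J₁ Y'` and `Y' = B - l J Y` gives `(1 + l J₁ J) Y = A + J₁ B`.
  -- Inversion is continuous at units, which gives continuity in `l`.
  let Y : ℝ → C(Icc (0 : ℝ) 1, ℝ) := fun l => Ring.inverse (1 + l • (J₁ * J)) (A + J₁ B)
  let Y' : ℝ → C(Icc (0 : ℝ) 1, ℝ) := fun l => B - l • J (Y l)
  have hYc : Continuous Y := by
    have h1 : Continuous fun l : ℝ => Ring.inverse (1 + l • (J₁ * J)) := by
      rw [continuous_iff_continuousAt]
      intro l
      obtain ⟨v, hv⟩ := hunit l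
      have h2 : ContinuousAt Ring.inverse (1 + l • (J₁ * J)) :=
        hv ▸ NormedRing.inverse_continuousAt
          (R := C(Icc (0 : ℝ) 1, ℝ) →L[ℝ] C(Icc (0 : ℝ) 1, ℝ)) v
      exact h2.comp (f := fun l : ℝ => 1 + l • (J₁ * J)) (by fun_prop)
    exact h1.clm_apply continuous_const
  have hY'c : Continuous Y' := by fun_prop
  have hYeq : ∀ l, Y l = A + J₁ (Y' l) := by
    intro l
    have h1 : (1 + l • (J₁ * J)) (Y l) = A + J₁ B := by
      change ((1 + l • (J₁ * J)) * Ring.inverse (1 + l • (J₁ * J))) (A + J₁ B) = _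
      rw [Ring.mul_inverse_cancel _ (hunit l)]
      rfl
    have h2 : Y l + l • J₁ (J (Y l)) = A + J₁ B := h1
    simp only [Y', map_sub, map_smul]
    rw [← add_sub_assoc, ← h2]
    simp
  have hjoint : ∀ {Z : ℝ → C(Icc (0 : ℝ) 1, ℝ)}, Continuous Z →
      Continuous (fun z : ℝ × ℝ => IccExtend (zero_le_one' ℝ) (Z z.1) z.2) := by
    intro Z hZ
    have h1 : Continuous fun z : ℝ × ℝ => projIcc (0 : ℝ) 1 zero_le_one z.2 :=
      continuous_projIcc.comp continuous_snd
    have h2 : Continuous fun z : ℝ × ℝ => Z z.1 := hZ.comp continuous_fst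
    exact h2.eval h1
  have h01 : (0 : ℝ) ∈ Icc (0 : ℝ) 1 := left_mem_Icc.2 zero_le_one
  refine ⟨fun l => IccExtend (zero_le_one' ℝ) (Y l), fun l => IccExtend (zero_le_one' ℝ) (Y' l),
    hjoint hYc, hjoint hY'c, fun l => ⟨⟨?_, ?_, ?_⟩, ?_, ?_⟩⟩
  · intro x hx
    have hc : Continuous (IccExtend (zero_le_one' ℝ) (Y' l)) := (Y' l).continuous.Icc_extend'
    have hd := ((hc.integral_hasStrictDerivAt 0 x).hasDerivAt.const_add a).hasDerivWithinAt
      (s := Icc 0 1)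
    refine hd.congr (fun t ht => ?_) ?_
    all_goals
      beta_reduce
      rw [IccExtend_of_mem _ _ (by assumption), hYeq, ContinuousMap.add_apply, hJ₁]
      simp [A]
  · exact (Y' l).continuous.Icc_extend'.continuousOn
  · intro x hx hpx
    have hxI := Ioo_subset_Icc_self hx
    have hc : Continuous (IccExtend (zero_le_one' ℝ) (Y l)) := (Y l).continuous.Icc_extend'
    have hint := intervalIntegrable_mul_iccExtend hp.integrableOn (Y l) hxI
    have hmeas : StronglyMeasurableAtFilter
        (fun t => p t * IccExtend (zero_le_one' ℝ) (Y l) t) (𝓝 x) := by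
      refine AEStronglyMeasurable.stronglyMeasurableAtFilter_of_mem (s := Icc 0 1) ?_
        (Icc_mem_nhds hx.1 hx.2)
      exact hp.integrableOn.aestronglyMeasurable.mul hc.aestronglyMeasurable
    have hd := ((intervalIntegral.integral_hasDerivAt_right hint hmeas
      (hpx.mul hc.continuousAt)).const_mul l).const_sub b
    refine (hd.congr_of_eventuallyEq ?_).congr_deriv (by ring)
    filter_upwards [Icc_mem_nhds hx.1 hx.2] with t ht
    rw [IccExtend_of_mem _ _ ht]
    simp [Y', B, hJ]
  · beta_reduce
    rw [IccExtend_of_mem _ _ h01, hYeq, ContinuousMap.add_apply, hJ₁]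
    simp [A]
  · beta_reduce
    rw [IccExtend_of_mem _ _ h01]
    simp [Y', B, hJ]

end RealSolutions

end VibratingString

namespace VibratingString

/-! ### Real solutions: Wronskian and behaviour at the end points -/

section RealSolutionLemmas

variable {p : ℝ → ℝ} {l : ℝ} {y y' : ℝ → ℝ}

theorem IsRealSolution.continuousOn (h : IsRealSolution p l y y') : ContinuousOn y (Icc 0 1) :=
  fun x hx => (h.hasDeriv x hx).continuousWithinAt

theorem IsRealSolution.hasDerivAt (h : IsRealSolution p l y y') {x : ℝ} (hx : x ∈ Ioo (0 : ℝ) 1) :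
    HasDerivAt y (y' x) x :=
  (h.hasDeriv x (Ioo_subset_Icc_self hx)).hasDerivAt (Icc_mem_nhds hx.1 hx.2)

theorem IsRealSolution.isSolution (h : IsRealSolution p l y y') :
    IsSolution p (l : ℂ) (fun x => (y x : ℂ)) (fun x => (y' x : ℂ)) where
  hasDeriv x hx := (h.hasDeriv x hx).ofReal_comp
  continuousOn_deriv := Complex.continuous_ofReal.comp_continuousOn h.continuousOn_deriv
  equation x hx hpx := (h.equation x hx hpx).ofReal_comp.congr_deriv (by push_cast; ring)

theorem IsRealSolution.eq_zero (hp : IsDensity p) (h : IsRealSolution p l y y') {x₀ : ℝ}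
    (hx₀ : x₀ ∈ Icc (0 : ℝ) 1) (h0 : y x₀ = 0) (h0' : y' x₀ = 0) :
    ∀ x ∈ Icc (0 : ℝ) 1, y x = 0 ∧ y' x = 0 := by
  intro x hx
  have := h.isSolution.eq_zero hp hx₀ (by simpa using h0) (by simpa using h0') x hx
  simpa using this

/-- A linear functional of a complex solution with real parameter is a real solution. -/
theorem IsSolution.isRealSolution_comp {u u' : ℝ → ℂ} (h : IsSolution p (l : ℂ) u u')
    (L : ℂ →L[ℝ] ℝ) : IsRealSolution p l (fun x => L (u x)) (fun x => L (u' x)) where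
  hasDeriv x hx := L.hasFDerivAt.comp_hasDerivWithinAt x (h.hasDeriv x hx)
  continuousOn_deriv := L.continuous.comp_continuousOn h.continuousOn_deriv
  equation x hx hpx := (L.hasFDerivAt.comp_hasDerivAt x (h.equation x hx hpx)).congr_deriv (by
    have : (-((l : ℂ) * (p x : ℂ) * u x)) = (-(l * p x)) • u x := by
      rw [Complex.real_smul]; push_cast; ring
    rw [this, map_smul, smul_eq_mul]
    ring)

/-- The Wronskian of two solutions for the same parameter is constant. -/
theorem IsRealSolution.wronskian_eq (hp : IsDensity p) (h : IsRealSolution p l y y')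
    {v v' : ℝ → ℝ} (hv : IsRealSolution p l v v') :
    v 1 * y' 1 - v' 1 * y 1 = v 0 * y' 0 - v' 0 * y 0 := by
  have hc : ContinuousOn (fun x => v x * y' x - v' x * y x) (Icc 0 1) :=
    (hv.continuousOn.mul h.continuousOn_deriv).sub (hv.continuousOn_deriv.mul h.continuousOn)
  have hd : ∀ x ∈ Ioo (0 : ℝ) 1, x ∉ {x ∈ Ioo (0 : ℝ) 1 | ¬ ContinuousAt p x} →
      HasDerivAt (fun x => v x * y' x - v' x * y x) 0 x := by
    intro x hx hxs
    have hpx := continuousAt_of_notMem_discontinuities hx hxs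
    refine (((hv.hasDerivAt hx).mul (h.equation x hx hpx)).sub
      ((hv.equation x hx hpx).mul (h.hasDerivAt hx))).congr_deriv ?_
    ring
  have h0 : (0 : ℝ) ∈ Icc (0 : ℝ) 1 := left_mem_Icc.2 zero_le_one
  have h1 : (1 : ℝ) ∈ Icc (0 : ℝ) 1 := right_mem_Icc.2 zero_le_one
  refine le_antisymm ?_ ?_
  · exact antitoneOn_of_hasDerivAt_nonpos_off_finite hp.finite_discontinuities hc
      (f' := fun _ => 0) (fun x hx hxs => ⟨hd x hx hxs, le_rfl⟩) h0 h1 zero_le_one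
  · exact monotoneOn_of_hasDerivAt_nonneg_off_finite hp.finite_discontinuities hc
      (f' := fun _ => 0) (fun x hx hxs => ⟨hd x hx hxs, le_rfl⟩) h0 h1 zero_le_one

theorem hasDerivWithinAt_zero_nonpos {f : ℝ → ℝ} {d x₁ : ℝ}
    (hd : HasDerivWithinAt f d (Icc 0 1) 0) (hx₁ : x₁ ∈ Ioc (0 : ℝ) 1) (h0 : f 0 = 0)
    (hf : ∀ x ∈ Ioc 0 x₁, f x ≤ 0) : d ≤ 0 := by
  have h1 : HasDerivWithinAt f d (Ioi 0) 0 :=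
    (hd.mono_of_mem_nhdsWithin (Icc_mem_nhdsGT zero_lt_one))
  rw [hasDerivWithinAt_iff_tendsto_slope' (by simp)] at h1
  refine le_of_tendsto h1 ?_
  filter_upwards [Ioc_mem_nhdsGT hx₁.1] with t ht
  rw [slope_def_field, h0, sub_zero, sub_zero]
  exact div_nonpos_of_nonpos_of_nonneg (hf t ht) ht.1.le

theorem hasDerivWithinAt_one_nonpos {f : ℝ → ℝ} {d : ℝ}
    (hd : HasDerivWithinAt f d (Icc 0 1) 1) (h1 : f 1 = 0)
    (hf : ∀ x ∈ Ioo (0 : ℝ) 1, 0 ≤ f x) : d ≤ 0 := by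
  have h2 : HasDerivWithinAt f d (Iio 1) 1 :=
    (hd.mono_of_mem_nhdsWithin (Icc_mem_nhdsLT zero_lt_one))
  rw [hasDerivWithinAt_iff_tendsto_slope' (by simp)] at h2
  refine le_of_tendsto h2 ?_
  filter_upwards [Ioo_mem_nhdsLT (zero_lt_one' ℝ)] with t ht
  rw [slope_def_field, h1, sub_zero]
  exact div_nonpos_of_nonneg_of_nonpos (hf t ht) (by linarith [ht.2])

theorem IsRealSolution.deriv_zero_eq_zero (h : IsRealSolution p l y y') {x₁ : ℝ}
    (hx₁ : x₁ ∈ Ioc (0 : ℝ) 1) (hy : ∀ x ∈ Icc 0 x₁, y x = 0) : y' 0 = 0 := by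
  have hd := h.hasDeriv 0 (left_mem_Icc.2 zero_le_one)
  have h0 := hy 0 (left_mem_Icc.2 hx₁.1.le)
  refine le_antisymm (hasDerivWithinAt_zero_nonpos hd hx₁ h0
    fun x hx => (hy x (Ioc_subset_Icc_self hx)).le) ?_
  have := hasDerivWithinAt_zero_nonpos hd.neg hx₁ (by simpa using h0)
    fun x hx => by simpa using (hy x (Ioc_subset_Icc_self hx)).ge
  linarith

end RealSolutionLemmas

/-- A jointly continuous family of solutions satisfying the boundary condition at `0`. -/
structure IsShootingFamily (p : ℝ → ℝ) (α : ℝ) (y y' : ℝ → ℝ → ℝ) : Prop where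
  continuous : Continuous (fun z : ℝ × ℝ => y z.1 z.2)
  continuous_deriv : Continuous (fun z : ℝ × ℝ => y' z.1 z.2)
  isRealSolution : ∀ l, IsRealSolution p l (y l) (y' l)
  apply_zero : ∀ l, y l 0 = Real.sin α
  deriv_apply_zero : ∀ l, y' l 0 = -Real.cos α

/-- The boundary form at `1` of a family of solutions; its zeros are the eigenvalues. -/
noncomputable def characteristicFunction (β : ℝ) (y y' : ℝ → ℝ → ℝ) (l : ℝ) : ℝ :=
  y l 1 * Real.cos β + y' l 1 * Real.sin β

theorem IsDensity.exists_shootingFamily {p : ℝ → ℝ} (hp : IsDensity p) (α : ℝ) :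
    ∃ y y', IsShootingFamily p α y y' := by
  obtain ⟨y, y', h1, h2, h3⟩ := hp.exists_solution_family (Real.sin α) (-Real.cos α)
  exact ⟨y, y', h1, h2, fun l => (h3 l).1, fun l => (h3 l).2.1, fun l => (h3 l).2.2⟩

/-! ### Shooting solutions and their boundary form -/

namespace IsShootingFamily

variable {p : ℝ → ℝ} {α β : ℝ} {y y' : ℝ → ℝ → ℝ}

theorem not_both_zero (h : IsShootingFamily p α y y') (hp : IsDensity p) {l x : ℝ}
    (hx : x ∈ Icc (0 : ℝ) 1) (h0 : y l x = 0) : y' l x ≠ 0 := by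
  intro h0'
  have h1 := (h.isRealSolution l).eq_zero hp hx h0 h0' 0 (left_mem_Icc.2 zero_le_one)
  rw [h.apply_zero, h.deriv_apply_zero] at h1
  have := Real.sin_sq_add_cos_sq α
  nlinarith [h1.1, h1.2]

theorem continuous_characteristicFunction (h : IsShootingFamily p α y y') (β : ℝ) :
    Continuous (characteristicFunction β y y') := by
  have h1 : Continuous fun l : ℝ => y l 1 :=
    h.continuous.comp (continuous_id.prodMk continuous_const)
  have h2 : Continuous fun l : ℝ => y' l 1 :=
    h.continuous_deriv.comp (continuous_id.prodMk continuous_const)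
  exact (h1.mul continuous_const).add (h2.mul continuous_const)

/-- The Wronskian of an eigenfunction and `y l` vanishes at `0`, hence at `1`. Together with the
condition at `1` this makes the boundary form times each Cauchy datum at `1` zero, and these data
are not both zero. -/
theorem isEigenvalue_iff (h : IsShootingFamily p α y y') (hp : IsDensity p) (l : ℝ) :
    IsEigenvalue p α β (l : ℂ) ↔ characteristicFunction β y y' l = 0 := by
  constructor
  · rintro ⟨u, u', hu, h0, h1, x₁, hx₁, hne⟩
    -- Real or imaginary part, whichever keeps the solution nontrivial.
    obtain ⟨L, hL⟩ : ∃ L : ℂ →L[ℝ] ℝ, L (u x₁) ≠ 0 := by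
      by_contra! hL
      exact hne (Complex.ext (hL Complex.reCLM) (hL Complex.imCLM))
    have hv := hu.isRealSolution_comp L
    have hb : ∀ {a b : ℂ} {θ : ℝ}, a * (Real.cos θ : ℂ) + b * (Real.sin θ : ℂ) = 0 →
        L a * Real.cos θ + L b * Real.sin θ = 0 := by
      intro a b θ hab
      have h2 := congrArg L hab
      rw [mul_comm a, mul_comm b, ← Complex.real_smul, ← Complex.real_smul, map_add, map_smul,
        map_smul, map_zero, smul_eq_mul, smul_eq_mul] at h2
      linarith
    have hb0 := hb h0
    have hb1 := hb h1
    have hW := (h.isRealSolution l).wronskian_eq hp hv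
    rw [h.apply_zero, h.deriv_apply_zero] at hW
    have hW' : L (u 1) * y' l 1 - L (u' 1) * y l 1 = 0 := by linarith
    have h3 : L (u 1) * characteristicFunction β y y' l = 0 := by
      rw [characteristicFunction]
      linear_combination y l 1 * hb1 + Real.sin β * hW'
    have h4 : L (u' 1) * characteristicFunction β y y' l = 0 := by
      rw [characteristicFunction]
      linear_combination y' l 1 * hb1 - Real.cos β * hW'
    by_contra hF
    refine hL (hv.eq_zero hp (right_mem_Icc.2 zero_le_one) ?_ ?_ x₁ hx₁).1
    · exact (mul_eq_zero.1 h3).resolve_right hF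
    · exact (mul_eq_zero.1 h4).resolve_right hF
  · intro hF
    refine ⟨_, _, (h.isRealSolution l).isSolution, ?_, ?_, ?_⟩
    · simp only [h.apply_zero, h.deriv_apply_zero]
      push_cast
      ring
    · have := congrArg (fun r : ℝ => (r : ℂ)) hF
      simpa [characteristicFunction] using this
    · by_contra! hall
      have hz : ∀ x ∈ Icc (0 : ℝ) 1, y l x = 0 := fun x hx => by simpa using hall x hx
      exact h.not_both_zero hp (left_mem_Icc.2 zero_le_one)
        (hz 0 (left_mem_Icc.2 zero_le_one))
        ((h.isRealSolution l).deriv_zero_eq_zero (right_mem_Ioc.2 zero_lt_one) hz)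

/-- The sign is constant, and it is positive near `0`: either `sin α > 0`, or `α = π` and the
initial slope is `1`. -/
theorem pos_of_ne_zero (h : IsShootingFamily p α y y') (hα : α ∈ Ioc 0 Real.pi) {l : ℝ}
    (hne : ∀ x ∈ Ioc (0 : ℝ) 1, y l x ≠ 0) : ∀ x ∈ Ioc (0 : ℝ) 1, 0 < y l x := by
  intro x₁ hx₁
  by_contra hlt
  have hneg : ∀ x ∈ Ioc 0 x₁, y l x < 0 := by
    intro x hx
    have hxI : x ∈ Ioc (0 : ℝ) 1 := ⟨hx.1, hx.2.trans hx₁.2⟩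
    by_contra hx0
    obtain ⟨z, hz, hz0⟩ : (0 : ℝ) ∈ y l '' Icc x x₁ :=
      intermediate_value_Icc' hx.2 ((h.isRealSolution l).continuousOn.mono
        (Icc_subset_Icc hx.1.le hx₁.2)) ⟨not_lt.1 hlt, not_lt.1 hx0⟩
    exact hne z ⟨hx.1.trans_le hz.1, hz.2.trans hx₁.2⟩ hz0
  rcases (Real.sin_nonneg_of_nonneg_of_le_pi hα.1.le hα.2).lt_or_eq with hs | hs
  · obtain ⟨z, hz, hz0⟩ : (0 : ℝ) ∈ y l '' Icc 0 x₁ :=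
      intermediate_value_Icc' hx₁.1.le ((h.isRealSolution l).continuousOn.mono
        (Icc_subset_Icc_right hx₁.2)) ⟨not_lt.1 hlt, by rw [h.apply_zero]; exact hs.le⟩
    refine hne z ⟨lt_of_le_of_ne hz.1 ?_, hz.2.trans hx₁.2⟩ hz0
    rintro rfl
    rw [h.apply_zero] at hz0
    exact hs.ne' hz0
  · have hd := hasDerivWithinAt_zero_nonpos
      ((h.isRealSolution l).hasDeriv 0 (left_mem_Icc.2 zero_le_one)) hx₁
      (by rw [h.apply_zero, hs]) (fun x hx => (hneg x hx).le)
    rw [h.deriv_apply_zero] at hd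
    have hα' : α = Real.pi := by
      by_contra hne'
      exact (Real.sin_pos_of_pos_of_lt_pi hα.1 (lt_of_le_of_ne hα.2 hne')).ne hs
    rw [hα', Real.cos_pi] at hd
    norm_num at hd

/-- For very negative parameters the solution has no zeros and the boundary form is positive. -/
theorem exists_forall_le_pos (h : IsShootingFamily p α y y') (hp : IsDensity p)
    (hα : α ∈ Ioc 0 Real.pi) (hβ : β ∈ Ico 0 Real.pi) :
    ∃ b : ℝ, ∀ l ≤ b, (∀ x ∈ Ioc (0 : ℝ) 1, 0 < y l x) ∧
      0 < characteristicFunction β y y' l := by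
  obtain ⟨m, hm, hpm⟩ := hp.bounded_away
  have hs := Real.sin_nonneg_of_nonneg_of_le_pi hα.1.le hα.2
  -- The aim is `y' / y ≥ q` for the line `q` from `-A` to `B`: `A` makes this hold at `0`, and `B`
  -- makes it imply a positive boundary form at `1`.
  obtain ⟨A, hA, hA'⟩ : ∃ A : ℝ, 0 ≤ A ∧
      0 ≤ Real.sin α * (-Real.cos α + A * Real.sin α) := by
    rcases hs.lt_or_eq with hs | hs
    · refine ⟨|Real.cos α| / Real.sin α, by positivity, ?_⟩
      rw [div_mul_cancel₀ _ hs.ne']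
      exact mul_nonneg hs.le (by linarith [le_abs_self (Real.cos α)])
    · exact ⟨0, le_rfl, by rw [← hs]; simp⟩
  obtain ⟨B, hB, hB'⟩ : ∃ B : ℝ, 0 ≤ B ∧ 0 < Real.cos β + B * Real.sin β := by
    rcases hβ.1.lt_or_eq with hb | hb
    · have hsb := Real.sin_pos_of_pos_of_lt_pi hb hβ.2
      refine ⟨(|Real.cos β| + 1) / Real.sin β, by positivity, ?_⟩
      rw [div_mul_cancel₀ _ hsb.ne']
      linarith [neg_abs_le (Real.cos β)]
    · exact ⟨0, le_rfl, by rw [← hb]; simp⟩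
  have hsb := Real.sin_nonneg_of_nonneg_of_le_pi hβ.1 hβ.2.le
  set N := A + B with hN
  have hN0 : 0 ≤ N := by positivity
  refine ⟨-((N + N ^ 2) / m), fun l hl => ?_⟩
  have hlm : N + N ^ 2 ≤ -l * m := by
    have : (N + N ^ 2) / m ≤ -l := by linarith
    rwa [div_le_iff₀ hm] at this
  have hl0 : 0 ≤ -l := by
    have : 0 ≤ (N + N ^ 2) / m := by positivity
    linarith
  have hsol := h.isRealSolution l
  set q : ℝ → ℝ := fun x => -A + N * x with hq
  have hqd : ∀ x, HasDerivAt q N x := fun x => by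
    exact (((hasDerivAt_id' x).const_mul N).const_add (-A)).congr_deriv (mul_one N)
  have hqc : Continuous q := by fun_prop
  have h0 : (0 : ℝ) ∈ Icc (0 : ℝ) 1 := left_mem_Icc.2 zero_le_one
  have h1 : (1 : ℝ) ∈ Icc (0 : ℝ) 1 := right_mem_Icc.2 zero_le_one
  -- Riccati comparison, multiplied by `y²` so that zeros of `y` do no harm. It needs `q' + q² ≤ -l
  -- p`, which holds since `q' = N`, `|q| ≤ N` and `N + N² ≤ -l m`.
  have hE : ∀ x ∈ Icc (0 : ℝ) 1, 0 ≤ y l x * (y' l x - q x * y l x) := by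
    have hmono : MonotoneOn (fun x => y l x * (y' l x - q x * y l x)) (Icc 0 1) := by
      refine monotoneOn_of_hasDerivAt_nonneg_off_finite hp.finite_discontinuities
        (hsol.continuousOn.mul (hsol.continuousOn_deriv.sub
          (hqc.continuousOn.mul hsol.continuousOn)))
        (f' := fun x => (y' l x - q x * y l x) ^ 2 + (-l * p x - N - q x ^ 2) * y l x ^ 2)
        (fun x hx hxs => ⟨?_, ?_⟩)
      · have d1 := hsol.hasDerivAt hx
        have d2 := hsol.equation x hx (continuousAt_of_notMem_discontinuities hx hxs)
        refine (d1.mul (d2.sub ((hqd x).mul d1))).congr_deriv ?_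
        simp only [Pi.sub_apply, Pi.mul_apply]
        ring
      · have hq2 : q x ^ 2 ≤ N ^ 2 := by
          refine sq_le_sq' ?_ ?_
          · simp only [hq]; nlinarith [hx.1, mul_nonneg hN0 hx.1.le]
          · simp only [hq]; nlinarith [hx.2, mul_nonneg hN0 (sub_nonneg.2 hx.2.le)]
        have hp2 : -l * m ≤ -l * p x :=
          mul_le_mul_of_nonneg_left (hpm x (Ioo_subset_Icc_self hx)) hl0
        have : 0 ≤ -l * p x - N - q x ^ 2 := by linarith
        positivity
    intro x hx
    refine le_trans ?_ (hmono h0 hx hx.1)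
    simp only [h.apply_zero, h.deriv_apply_zero, hq]
    simpa using hA'
  -- The weight is `exp (-2 ∫ q)`. A zero of `y` at `x` then forces `y = 0` on all of `[0, x]`.
  have hG : MonotoneOn (fun x => y l x ^ 2 * Real.exp (2 * A * x - N * x ^ 2)) (Icc 0 1) := by
    refine monotoneOn_of_hasDerivAt_nonneg_off_finite hp.finite_discontinuities
      ((hsol.continuousOn.pow 2).mul (by fun_prop))
      (f' := fun x => 2 * Real.exp (2 * A * x - N * x ^ 2) *
        (y l x * (y' l x - q x * y l x))) (fun x hx hxs => ⟨?_, ?_⟩)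
    · have d1 := hsol.hasDerivAt hx
      have d3 : HasDerivAt (fun x : ℝ => 2 * A * x - N * x ^ 2) (2 * A - N * (2 * x)) x := by
        refine (((hasDerivAt_id' x).const_mul (2 * A)).sub
          ((hasDerivAt_pow 2 x).const_mul N)).congr_deriv ?_
        simp
      refine ((d1.pow 2).mul d3.exp).congr_deriv ?_
      simp only [hq, Pi.pow_apply]
      ring
    · have := hE x (Ioo_subset_Icc_self hx)
      positivity
  have hpos : ∀ x ∈ Ioc (0 : ℝ) 1, 0 < y l x := by
    refine h.pos_of_ne_zero hα fun x hx hx0 => ?_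
    have hz : ∀ t ∈ Icc 0 x, y l t = 0 := by
      intro t ht
      have h2 := hG ⟨ht.1, ht.2.trans hx.2⟩ (Ioc_subset_Icc_self hx) ht.2
      simp only [hx0] at h2
      have h3 : y l t ^ 2 ≤ 0 := by
        refine nonpos_of_mul_nonpos_left (h2.trans_eq ?_) (Real.exp_pos _)
        simp
      exact pow_eq_zero_iff two_ne_zero |>.1 (le_antisymm h3 (sq_nonneg _))
    exact h.not_both_zero hp h0 (hz 0 (left_mem_Icc.2 hx.1.le)) (hsol.deriv_zero_eq_zero hx hz)
  refine ⟨hpos, ?_⟩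
  have hy1 := hpos 1 (right_mem_Ioc.2 zero_lt_one)
  have h4 : 0 ≤ y' l 1 - q 1 * y l 1 := nonneg_of_mul_nonneg_right (hE 1 h1) hy1
  have hq1 : q 1 = B := by simp only [hq, hN]; ring
  rw [hq1] at h4
  rw [characteristicFunction]
  nlinarith [mul_pos hy1 hB', mul_nonneg h4 hsb]

/-- Sturm comparison with `sin (π x)`: for `l = π² / m` one has `l p ≥ π²`. If `y` were positive on
`(0, 1]`, the Wronskian would decrease from `-π sin α ≤ 0` to `π y(1) > 0`. -/
theorem exists_zero (h : IsShootingFamily p α y y') (hp : IsDensity p)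
    (hα : α ∈ Ioc 0 Real.pi) : ∃ l : ℝ, ∃ x ∈ Ioc (0 : ℝ) 1, y l x = 0 := by
  obtain ⟨m, hm, hpm⟩ := hp.bounded_away
  by_contra! hne
  set l := Real.pi ^ 2 / m with hl
  have hlm : l * m = Real.pi ^ 2 := div_mul_cancel₀ _ hm.ne'
  have hl0 : 0 ≤ l := by positivity
  have hpos := h.pos_of_ne_zero hα (hne l)
  have hsol := h.isRealSolution l
  have hs := Real.sin_nonneg_of_nonneg_of_le_pi hα.1.le hα.2
  have d3 : ∀ x : ℝ, HasDerivAt (fun x => Real.pi * x) Real.pi x := fun x => by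
    simpa using (hasDerivAt_id x).const_mul Real.pi
  have hanti : AntitoneOn (fun x => y' l x * Real.sin (Real.pi * x) -
      Real.pi * (y l x * Real.cos (Real.pi * x))) (Icc 0 1) := by
    refine antitoneOn_of_hasDerivAt_nonpos_off_finite hp.finite_discontinuities ?_
      (f' := fun x => (Real.pi ^ 2 - l * p x) * (y l x * Real.sin (Real.pi * x)))
      (fun x hx hxs => ⟨?_, ?_⟩)
    · exact (hsol.continuousOn_deriv.mul (by fun_prop)).sub
        (continuousOn_const.mul (hsol.continuousOn.mul (by fun_prop)))
    · have d1 := hsol.hasDerivAt hx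
      have d2 := hsol.equation x hx (continuousAt_of_notMem_discontinuities hx hxs)
      refine ((d2.mul (d3 x).sin).sub ((d1.mul (d3 x).cos).const_mul Real.pi)).congr_deriv ?_
      ring
    · have hy := hpos x (Ioo_subset_Ioc_self hx)
      have hsin : 0 ≤ Real.sin (Real.pi * x) :=
        Real.sin_nonneg_of_nonneg_of_le_pi (mul_nonneg Real.pi_pos.le hx.1.le)
          (mul_le_of_le_one_right Real.pi_pos.le hx.2.le)
      have hp2 : l * m ≤ l * p x :=
        mul_le_mul_of_nonneg_left (hpm x (Ioo_subset_Icc_self hx)) hl0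
      exact mul_nonpos_of_nonpos_of_nonneg (by linarith) (by positivity)
  have := hanti (left_mem_Icc.2 zero_le_one) (right_mem_Icc.2 zero_le_one) zero_le_one
  simp only [mul_zero, mul_one, Real.sin_zero, Real.cos_zero, Real.sin_pi, Real.cos_pi,
    h.apply_zero] at this
  nlinarith [hpos 1 (right_mem_Ioc.2 zero_lt_one), Real.pi_pos,
    mul_pos Real.pi_pos (hpos 1 (right_mem_Ioc.2 zero_lt_one)), mul_nonneg Real.pi_pos.le hs]

/-- The parameters for which the solution has a zero in `(0, 1]` form a sequentially closed set. -/
theorem exists_zero_of_tendsto (h : IsShootingFamily p α y y') (hp : IsDensity p)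
    {ls : ℕ → ℝ} {l : ℝ} (hls : Tendsto ls atTop (𝓝 l))
    (hz : ∀ n, ∃ x ∈ Ioc (0 : ℝ) 1, y (ls n) x = 0) : ∃ x ∈ Ioc (0 : ℝ) 1, y l x = 0 := by
  choose xs hxs hxs0 using hz
  obtain ⟨x, hx, φ, hφ, hlim⟩ := isCompact_Icc.tendsto_subseq
    (fun n => Ioc_subset_Icc_self (hxs n))
  have hlφ : Tendsto (ls ∘ φ) atTop (𝓝 l) := hls.comp hφ.tendsto_atTop
  have hy0 : y l x = 0 := by
    have h1 := (h.continuous.tendsto (l, x)).comp (hlφ.prodMk_nhds hlim)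
    refine tendsto_nhds_unique h1 (tendsto_const_nhds.congr fun n => ?_)
    exact (hxs0 (φ n)).symm
  rcases hx.1.lt_or_eq with hx0 | hx0
  · exact ⟨x, ⟨hx0, hx.2⟩, hy0⟩
  -- Zeros collapsing to `0` force `sin α = 0`; Rolle's theorem then yields critical points tending
  -- to `0`, so both Cauchy data vanish there.
  · exfalso
    subst hx0
    have hs : Real.sin α = 0 := by rw [← h.apply_zero l, hy0]
    have hrolle : ∀ n, ∃ t ∈ Ioo 0 (xs n), y' (ls n) t = 0 := fun n =>
      exists_hasDerivAt_eq_zero (hxs n).1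
        ((h.isRealSolution (ls n)).continuousOn.mono (Icc_subset_Icc_right (hxs n).2))
        (by rw [h.apply_zero, hs, hxs0])
        (fun t ht => (h.isRealSolution (ls n)).hasDerivAt ⟨ht.1, ht.2.trans_le (hxs n).2⟩)
    choose ts hts hts0 using hrolle
    have htlim : Tendsto (ts ∘ φ) atTop (𝓝 0) :=
      tendsto_of_tendsto_of_tendsto_of_le_of_le tendsto_const_nhds hlim
        (fun n => (hts (φ n)).1.le) (fun n => (hts (φ n)).2.le)
    have h1 := (h.continuous_deriv.tendsto (l, 0)).comp (hlφ.prodMk_nhds htlim)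
    refine h.not_both_zero hp (left_mem_Icc.2 zero_le_one) hy0 (tendsto_nhds_unique h1
      (tendsto_const_nhds.congr fun n => ?_))
    exact (hts0 (φ n)).symm

/-- The lowest parameter for which the solution has a zero in `(0, 1]`. -/
theorem exists_lowest_dirichlet (h : IsShootingFamily p α y y') (hp : IsDensity p)
    (hα : α ∈ Ioc 0 Real.pi) :
    ∃ k : ℝ, (∀ l < k, ∀ x ∈ Ioc (0 : ℝ) 1, 0 < y l x) ∧ (∀ x ∈ Ioo (0 : ℝ) 1, 0 < y k x) ∧
      y k 1 = 0 ∧ y' k 1 < 0 := by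
  set S : Set ℝ := {l | ∃ x ∈ Ioc (0 : ℝ) 1, y l x = 0} with hS
  have hne : S.Nonempty := h.exists_zero hp hα
  have hbdd : BddBelow S := by
    obtain ⟨b, hb⟩ := h.exists_forall_le_pos hp hα (left_mem_Ico.2 Real.pi_pos)
    refine ⟨b, fun l hl => ?_⟩
    obtain ⟨x, hx, hx0⟩ := hl
    by_contra hlt
    exact ((hb l (not_le.1 hlt).le).1 x hx).ne' hx0
  obtain ⟨ls, -, hls, hlsS⟩ := exists_seq_tendsto_sInf hne hbdd
  obtain ⟨x₀, hx₀, hx₀0⟩ := h.exists_zero_of_tendsto hp hls hlsS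
  set k := sInf S with hk
  have hlow : ∀ l < k, ∀ x ∈ Ioc (0 : ℝ) 1, 0 < y l x := fun l hl =>
    h.pos_of_ne_zero hα fun x hx hx0 => (csInf_le hbdd ⟨x, hx, hx0⟩).not_gt hl
  -- Limit from `l < k`. An interior zero of `y k` would be a minimum, hence a double zero; so the
  -- first zero appears at `1`.
  have hnonneg : ∀ x ∈ Ioc (0 : ℝ) 1, 0 ≤ y k x := by
    intro x hx
    have hc : Continuous fun l : ℝ => y l x :=
      h.continuous.comp (continuous_id.prodMk continuous_const)
    refine ge_of_tendsto (hc.continuousWithinAt (s := Iio k) (x := k)) ?_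
    filter_upwards [self_mem_nhdsWithin] with l hl using (hlow l hl x hx).le
  have hpos : ∀ x ∈ Ioo (0 : ℝ) 1, 0 < y k x := by
    intro x hx
    refine lt_of_le_of_ne (hnonneg x (Ioo_subset_Ioc_self hx)) fun h0 => ?_
    have hmin : IsLocalMin (y k) x := by
      filter_upwards [Ioo_mem_nhds hx.1 hx.2] with t ht
      rw [← h0]
      exact hnonneg t (Ioo_subset_Ioc_self ht)
    exact h.not_both_zero hp (Ioo_subset_Icc_self hx) h0.symm
      (hmin.hasDerivAt_eq_zero ((h.isRealSolution k).hasDerivAt hx))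
  have h1 : y k 1 = 0 := by
    rcases hx₀.2.lt_or_eq with hlt | heq
    · exact absurd hx₀0 (hpos x₀ ⟨hx₀.1, hlt⟩).ne'
    · rw [← heq, hx₀0]
  have h1m : (1 : ℝ) ∈ Icc (0 : ℝ) 1 := right_mem_Icc.2 zero_le_one
  refine ⟨k, hlow, hpos, h1, lt_of_le_of_ne ?_ (h.not_both_zero hp h1m h1)⟩
  exact hasDerivWithinAt_one_nonpos ((h.isRealSolution k).hasDeriv 1 h1m) h1
    fun x hx => (hpos x hx).le

theorem exists_root_le (h : IsShootingFamily p α y y') (hp : IsDensity p)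
    (hα : α ∈ Ioc 0 Real.pi) (hβ : β ∈ Ico 0 Real.pi) {l : ℝ}
    (hl : characteristicFunction β y y' l ≤ 0) :
    ∃ k ≤ l, characteristicFunction β y y' k = 0 := by
  obtain ⟨b, hb⟩ := h.exists_forall_le_pos hp hα hβ
  have hbl : b ≤ l := by
    by_contra hlt
    exact (hb l (not_le.1 hlt).le).2.not_ge hl
  obtain ⟨k, hk, hk0⟩ := intermediate_value_Icc' hbl
    (h.continuous_characteristicFunction β).continuousOn ⟨hl, (hb b le_rfl).2.le⟩
  exact ⟨k, hk.2, hk0⟩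

theorem zero_eq (h : IsShootingFamily p α y y') (hp : IsDensity p) {x : ℝ}
    (hx : x ∈ Icc (0 : ℝ) 1) :
    y 0 x = Real.sin α - Real.cos α * x ∧ y' 0 x = -Real.cos α := by
  have hsol := h.isRealSolution 0
  have hlin : ∀ x : ℝ, HasDerivAt (fun x => Real.sin α - Real.cos α * x) (-Real.cos α) x :=
    fun x => by simpa using ((hasDerivAt_id x).const_mul (Real.cos α)).const_sub (Real.sin α)
  have hdiff : IsRealSolution p 0 (fun x => y 0 x - (Real.sin α - Real.cos α * x))
      (fun x => y' 0 x - -Real.cos α) :=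
    { hasDeriv := fun x hx => (hsol.hasDeriv x hx).sub (hlin x).hasDerivWithinAt
      continuousOn_deriv := hsol.continuousOn_deriv.sub continuousOn_const
      equation := fun x hx hpx =>
        ((hsol.equation x hx hpx).sub_const _).congr_deriv (by ring) }
  have := hdiff.eq_zero hp (left_mem_Icc.2 zero_le_one) (by simp [h.apply_zero])
    (by simp [h.deriv_apply_zero]) x hx
  exact ⟨by linarith [this.1], by linarith [this.2]⟩

theorem characteristicFunction_zero (h : IsShootingFamily p α y y') (hp : IsDensity p) (β : ℝ) :
    characteristicFunction β y y' 0 =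
      (Real.sin α - Real.cos α) * Real.cos β - Real.cos α * Real.sin β := by
  have := h.zero_eq hp (right_mem_Icc.2 zero_le_one)
  rw [characteristicFunction, this.1, this.2]
  ring

/-- Sturm comparison of a positive solution for a negative parameter with the linear solution for
the parameter `0`. -/
theorem wronskian_linear_pos (h : IsShootingFamily p α y y') (hp : IsDensity p)
    (hα : α ∈ Ioc 0 Real.pi) (hαs : Real.cos α ≤ Real.sin α) {l : ℝ} (hl : l < 0)
    (hpos : ∀ x ∈ Ioo (0 : ℝ) 1, 0 < y l x) :
    0 < y' l 1 * (Real.sin α - Real.cos α) + y l 1 * Real.cos α := by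
  have hsol := h.isRealSolution l
  have hs := Real.sin_nonneg_of_nonneg_of_le_pi hα.1.le hα.2
  have hlin : ∀ x : ℝ, HasDerivAt (fun x => Real.sin α - Real.cos α * x) (-Real.cos α) x :=
    fun x => by simpa using ((hasDerivAt_id x).const_mul (Real.cos α)).const_sub (Real.sin α)
  -- The line is nonnegative at both ends and not identically zero.
  have hlinpos : ∀ x ∈ Ioo (0 : ℝ) 1, 0 < Real.sin α - Real.cos α * x := by
    intro x hx
    rcases le_or_gt (Real.cos α) 0 with hc | hc
    · rcases hs.lt_or_eq with hs | hs
      · nlinarith [hx.1]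
      · have : Real.cos α ≠ 0 := by
          intro h0
          have := Real.sin_sq_add_cos_sq α
          rw [h0, ← hs] at this
          norm_num at this
        have := lt_of_le_of_ne hc this
        nlinarith [hx.1]
    · nlinarith [hx.2]
  -- The Wronskian with the line starts at `0`, as the Cauchy data agree, and increases strictly
  -- because `-l > 0`.
  have hlt := lt_of_hasDerivAt_pos_off_finite hp.finite_discontinuities (zero_lt_one' ℝ)
    (f := fun x => y' l x * (Real.sin α - Real.cos α * x) + y l x * Real.cos α)
    (f' := fun x => -l * p x * y l x * (Real.sin α - Real.cos α * x))
    ((hsol.continuousOn_deriv.mul (by fun_prop)).add (hsol.continuousOn.mul continuousOn_const))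
    (fun x hx hxs => ⟨?_, ?_⟩)
  · simp only [h.apply_zero, h.deriv_apply_zero, mul_zero, mul_one] at hlt
    nlinarith
  · have d1 := hsol.hasDerivAt hx
    have d2 := hsol.equation x hx (continuousAt_of_notMem_discontinuities hx hxs)
    refine ((d2.mul (hlin x)).add (d1.mul_const (Real.cos α))).congr_deriv ?_
    ring
  · have h1 := hpos x hx
    have h2 := hlinpos x hx
    have h3 := hp.pos (Ioo_subset_Icc_self hx)
    have h4 : 0 < -l := by linarith
    positivity

/-- If the linear solution is positive on `(0, 1)` and its boundary form is nonnegative, then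
there are no negative eigenvalues. -/
theorem characteristicFunction_pos_of_neg (h : IsShootingFamily p α y y') (hp : IsDensity p)
    (hα : α ∈ Ioc 0 Real.pi) (hβ : β ∈ Ico 0 Real.pi) (hαs : Real.cos α ≤ Real.sin α)
    (h0 : 0 ≤ characteristicFunction β y y' 0) {l : ℝ} (hl : l < 0) :
    0 < characteristicFunction β y y' l := by
  obtain ⟨k, hk, hkpos, hk1, hk1'⟩ := h.exists_lowest_dirichlet hp hα
  -- For `k < 0` the Wronskian at `1` would reduce to `y' k 1 (sin α - cos α) ≤ 0`.
  have hk0 : 0 ≤ k := by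
    by_contra hlt
    have := h.wronskian_linear_pos hp hα hαs (not_le.1 hlt) hkpos
    rw [hk1] at this
    nlinarith [mul_nonneg (sub_nonneg.2 hαs) (neg_nonneg.2 hk1'.le)]
  have hpos := hk l (hl.trans_le hk0)
  have hW := h.wronskian_linear_pos hp hα hαs hl fun x hx => hpos x (Ioo_subset_Ioc_self hx)
  have hy1 := hpos 1 (right_mem_Ioc.2 zero_lt_one)
  rw [h.characteristicFunction_zero hp] at h0
  rw [characteristicFunction]
  -- With `W` the Wronskian at `1`, `(sin α - cos α) F(l) = W sin β + F(0) y(1)`. For `β = 0` the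
  -- boundary form is just `y(1)`.
  rcases hβ.1.lt_or_eq with hb | hb
  · have hsb := Real.sin_pos_of_pos_of_lt_pi hb hβ.2
    have hlt : Real.cos α < Real.sin α := by
      refine lt_of_le_of_ne hαs fun heq => ?_
      rw [heq, sub_self, zero_mul, zero_sub] at h0
      have h1 : 0 ≤ Real.sin α := Real.sin_nonneg_of_nonneg_of_le_pi hα.1.le hα.2
      have h2 : Real.sin α = 0 := by nlinarith
      have := Real.sin_sq_add_cos_sq α
      rw [heq, h2] at this
      norm_num at this
    refine pos_of_mul_pos_right (a := Real.sin α - Real.cos α) ?_ (sub_nonneg.2 hαs)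
    nlinarith [mul_pos hW hsb, mul_nonneg h0 hy1.le]
  · rw [← hb]
    simpa using hy1

end IsShootingFamily

/-! ### The parameter regions -/

section Trigonometry

variable {α β : ℝ}

theorem cos_le_sin_iff (hα : α ∈ Ioc 0 Real.pi) :
    Real.cos α ≤ Real.sin α ↔ Real.pi / 4 ≤ α := by
  have h1 : Real.sin (α - Real.pi / 4) = (Real.sin α - Real.cos α) * (√2 / 2) := by
    rw [Real.sin_sub, Real.cos_pi_div_four, Real.sin_pi_div_four]
    ring
  have h2 : (0 : ℝ) < √2 / 2 := by positivity
  have hpi := Real.pi_pos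
  constructor
  · intro h
    by_contra hlt
    have := Real.sin_neg_of_neg_of_neg_pi_lt (x := α - Real.pi / 4) (by linarith)
      (by linarith [hα.1])
    rw [h1] at this
    nlinarith
  · intro h
    have := Real.sin_nonneg_of_nonneg_of_le_pi (x := α - Real.pi / 4) (by linarith)
      (by linarith [hα.2])
    rw [h1] at this
    linarith [nonneg_of_mul_nonneg_left this h2]

theorem cos_add_sin_nonneg_iff (hβ : β ∈ Ico 0 Real.pi) :
    0 ≤ Real.cos β + Real.sin β ↔ β ≤ 3 * Real.pi / 4 := by
  have h := cos_le_sin_iff (α := Real.pi - β) ⟨by linarith [hβ.2], by linarith [hβ.1]⟩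
  rw [Real.cos_pi_sub, Real.sin_pi_sub] at h
  constructor
  · intro h'
    linarith [h.1 (by linarith)]
  · intro h'
    linarith [h.2 (by linarith)]

theorem boundary_determinant_eq : Real.cos α * Real.cos β - Real.sin (α - β) =
    -((Real.sin α - Real.cos α) * Real.cos β - Real.cos α * Real.sin β) := by
  rw [Real.sin_sub]
  ring

/-- The determinant equals `(sin α - cos α)(cos β + sin β) - sin α sin β`. If `cos β + sin β < 0`,
both terms are nonpositive, so both vanish, giving `sin α = cos α = 0`. Thus the bound on `β` in the
regions is automatic. -/
theorem le_three_pi_div_four (hα : α ∈ Ioc 0 Real.pi) (hβ : β ∈ Ico 0 Real.pi)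
    (hαs : Real.cos α ≤ Real.sin α)
    (h : 0 ≤ (Real.sin α - Real.cos α) * Real.cos β - Real.cos α * Real.sin β) :
    β ≤ 3 * Real.pi / 4 := by
  rw [← cos_add_sin_nonneg_iff hβ]
  by_contra hlt
  have hs := Real.sin_nonneg_of_nonneg_of_le_pi hα.1.le hα.2
  have hsb : 0 < Real.sin β := by
    refine lt_of_le_of_ne (Real.sin_nonneg_of_nonneg_of_le_pi hβ.1 hβ.2.le) fun h0 => ?_
    rcases hβ.1.lt_or_eq with hb | hb
    · exact (Real.sin_pos_of_pos_of_lt_pi hb hβ.2).ne h0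
    · rw [← hb] at hlt
      norm_num at hlt
  have h1 : (Real.sin α - Real.cos α) * (Real.cos β + Real.sin β) ≤ 0 :=
    mul_nonpos_of_nonneg_of_nonpos (sub_nonneg.2 hαs) (not_le.1 hlt).le
  have h2 : 0 ≤ Real.sin α * Real.sin β := mul_nonneg hs hsb.le
  have h3 : Real.sin α = 0 := by
    have : Real.sin α * Real.sin β = 0 := by linarith
    exact (mul_eq_zero.1 this).resolve_right hsb.ne'
  have h4 : Real.sin α - Real.cos α = 0 := by
    have : (Real.sin α - Real.cos α) * (Real.cos β + Real.sin β) = 0 := by linarith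
    exact (mul_eq_zero.1 this).resolve_right (not_le.1 hlt).ne
  have := Real.sin_sq_add_cos_sq α
  rw [show Real.cos α = 0 by linarith, h3] at this
  norm_num at this

theorem lt_of_boundary_pos (hα : α ∈ Ioc 0 Real.pi) (hβ : β ∈ Ico 0 Real.pi)
    (hαs : Real.cos α ≤ Real.sin α)
    (h : 0 < (Real.sin α - Real.cos α) * Real.cos β - Real.cos α * Real.sin β) :
    Real.pi / 4 < α ∧ β < 3 * Real.pi / 4 := by
  have hs := Real.sin_nonneg_of_nonneg_of_le_pi hα.1.le hα.2
  have hsb := Real.sin_nonneg_of_nonneg_of_le_pi hβ.1 hβ.2.le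
  constructor
  · refine lt_of_le_of_ne ((cos_le_sin_iff hα).1 hαs) ?_
    rintro rfl
    rw [Real.sin_pi_div_four, Real.cos_pi_div_four] at h
    have : 0 ≤ √2 / 2 * Real.sin β := mul_nonneg (by positivity) hsb
    linarith
  · refine lt_of_le_of_ne (le_three_pi_div_four hα hβ hαs h.le) ?_
    intro heq
    have h1 : Real.cos β + Real.sin β = 0 := by
      rw [heq, show 3 * Real.pi / 4 = Real.pi - Real.pi / 4 by ring, Real.cos_pi_sub,
        Real.sin_pi_sub, Real.sin_pi_div_four, Real.cos_pi_div_four]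
      ring
    have h2 : 0 ≤ Real.sin α * Real.sin β := mul_nonneg hs hsb
    have h3 : (Real.sin α - Real.cos α) * (Real.cos β + Real.sin β) = 0 := by rw [h1, mul_zero]
    linarith

theorem onCurve_iff (hα : α ∈ Ioc 0 Real.pi) (hβ : β ∈ Ico 0 Real.pi) :
    OnCurve α β ↔ Real.cos α ≤ Real.sin α ∧
      (Real.sin α - Real.cos α) * Real.cos β - Real.cos α * Real.sin β = 0 := by
  rw [OnCurve, boundary_determinant_eq, neg_eq_zero, cos_le_sin_iff hα]
  constructor
  · rintro ⟨h1, -, h2⟩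
    exact ⟨h1.1, h2⟩
  · rintro ⟨h1, h2⟩
    exact ⟨⟨h1, hα.2⟩, ⟨hβ.1, le_three_pi_div_four hα hβ ((cos_le_sin_iff hα).2 h1) h2.ge⟩, h2⟩

theorem inPositiveRegion_iff (hα : α ∈ Ioc 0 Real.pi) (hβ : β ∈ Ico 0 Real.pi) :
    InPositiveRegion α β ↔ Real.cos α ≤ Real.sin α ∧
      0 < (Real.sin α - Real.cos α) * Real.cos β - Real.cos α * Real.sin β := by
  rw [InPositiveRegion, boundary_determinant_eq, neg_lt_zero]
  constructor
  · rintro ⟨h1, -, h2⟩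
    exact ⟨(cos_le_sin_iff hα).2 h1.1.le, h2⟩
  · rintro ⟨h1, h2⟩
    obtain ⟨h3, h4⟩ := lt_of_boundary_pos hα hβ h1 h2
    exact ⟨⟨h3, hα.2⟩, ⟨hβ.1, h4⟩, h2⟩

end Trigonometry

/-! ### The lowest eigenvalue and its sign -/

section LowestEigenvalue

variable {p : ℝ → ℝ} {α β : ℝ}

theorem isLeast_lowestEigenvalue (hp : IsDensity p) (hα : α ∈ Ioc 0 Real.pi)
    (hβ : β ∈ Ico 0 Real.pi) :
    IsLeast {l : ℝ | IsEigenvalue p α β (l : ℂ)} (lowestEigenvalue p α β) := by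
  obtain ⟨y, y', h⟩ := hp.exists_shootingFamily α
  have hset : {l : ℝ | IsEigenvalue p α β (l : ℂ)} = characteristicFunction β y y' ⁻¹' {0} := by
    ext l
    exact h.isEigenvalue_iff hp l
  have hclosed : IsClosed {l : ℝ | IsEigenvalue p α β (l : ℂ)} := by
    rw [hset]
    exact isClosed_singleton.preimage (h.continuous_characteristicFunction β)
  have hne : {l : ℝ | IsEigenvalue p α β (l : ℂ)}.Nonempty := by
    obtain ⟨k, -, -, hk1, hk1'⟩ := h.exists_lowest_dirichlet hp hα
    obtain ⟨l, -, hl⟩ := h.exists_root_le hp hα hβ (l := k) (by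
      rw [characteristicFunction, hk1, zero_mul, zero_add]
      exact mul_nonpos_of_nonpos_of_nonneg hk1'.le
        (Real.sin_nonneg_of_nonneg_of_le_pi hβ.1 hβ.2.le))
    exact ⟨l, (h.isEigenvalue_iff hp l).2 hl⟩
  have hbdd : BddBelow {l : ℝ | IsEigenvalue p α β (l : ℂ)} := by
    obtain ⟨b, hb⟩ := h.exists_forall_le_pos hp hα hβ
    refine ⟨b, fun l hl => ?_⟩
    by_contra hlt
    exact (hb l (not_le.1 hlt).le).2.ne' ((h.isEigenvalue_iff hp l).1 hl)
  exact ⟨hclosed.csInf_mem hne hbdd, fun l hl => csInf_le hbdd hl⟩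

theorem lowestEigenvalue_eq_zero (hp : IsDensity p) (hα : α ∈ Ioc 0 Real.pi)
    (hβ : β ∈ Ico 0 Real.pi) (hαs : Real.cos α ≤ Real.sin α)
    (h0 : (Real.sin α - Real.cos α) * Real.cos β - Real.cos α * Real.sin β = 0) :
    lowestEigenvalue p α β = 0 := by
  obtain ⟨y, y', h⟩ := hp.exists_shootingFamily α
  have hleast := isLeast_lowestEigenvalue hp hα hβ
  have hF0 : characteristicFunction β y y' 0 = 0 := (h.characteristicFunction_zero hp β).trans h0
  refine le_antisymm (hleast.2 ((h.isEigenvalue_iff hp 0).2 hF0)) ?_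
  by_contra hlt
  exact (h.characteristicFunction_pos_of_neg hp hα hβ hαs hF0.ge (not_le.1 hlt)).ne'
    ((h.isEigenvalue_iff hp _).1 hleast.1)

theorem lowestEigenvalue_pos (hp : IsDensity p) (hα : α ∈ Ioc 0 Real.pi)
    (hβ : β ∈ Ico 0 Real.pi) (hαs : Real.cos α ≤ Real.sin α)
    (h0 : 0 < (Real.sin α - Real.cos α) * Real.cos β - Real.cos α * Real.sin β) :
    0 < lowestEigenvalue p α β := by
  obtain ⟨y, y', h⟩ := hp.exists_shootingFamily α
  have hroot := (h.isEigenvalue_iff hp _).1 (isLeast_lowestEigenvalue hp hα hβ).1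
  have hF0 : 0 < characteristicFunction β y y' 0 :=
    h0.trans_eq (h.characteristicFunction_zero hp β).symm
  by_contra hle
  rcases (not_lt.1 hle).lt_or_eq with hlt | heq
  · exact (h.characteristicFunction_pos_of_neg hp hα hβ hαs hF0.le hlt).ne' hroot
  · rw [heq] at hroot
    exact hF0.ne' hroot

theorem lowestEigenvalue_neg (hp : IsDensity p) (hα : α ∈ Ioc 0 Real.pi)
    (hβ : β ∈ Ico 0 Real.pi) (h0 : Real.sin α < Real.cos α ∨
      (Real.sin α - Real.cos α) * Real.cos β - Real.cos α * Real.sin β < 0) :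
    lowestEigenvalue p α β < 0 := by
  obtain ⟨y, y', h⟩ := hp.exists_shootingFamily α
  have hleast := isLeast_lowestEigenvalue hp hα hβ
  rcases h0 with hlt | hF
  · obtain ⟨k, hk, hkpos, hk1, hk1'⟩ := h.exists_lowest_dirichlet hp hα
    -- The line ends below zero at `1`, whereas for `k ≥ 0` minimality of `k` would give `y 0 1 ≥
    -- 0`.
    have hk0 : k < 0 := by
      by_contra hk0
      have h1 : y 0 1 < 0 := by
        rw [(h.zero_eq hp (right_mem_Icc.2 zero_le_one)).1]
        linarith
      rcases (not_lt.1 hk0).lt_or_eq with h2 | h2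
      · exact (hk 0 h2 1 (right_mem_Ioc.2 zero_lt_one)).not_gt h1
      · rw [← h2] at hk1
        exact h1.ne hk1
    obtain ⟨l, hlk, hl⟩ := h.exists_root_le hp hα hβ (l := k) (by
      rw [characteristicFunction, hk1, zero_mul, zero_add]
      exact mul_nonpos_of_nonpos_of_nonneg hk1'.le
        (Real.sin_nonneg_of_nonneg_of_le_pi hβ.1 hβ.2.le))
    exact (hleast.2 ((h.isEigenvalue_iff hp l).2 hl)).trans_lt (hlk.trans_lt hk0)
  · rw [← h.characteristicFunction_zero hp β] at hF
    obtain ⟨l, hl0, hl⟩ := h.exists_root_le hp hα hβ hF.le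
    refine (hleast.2 ((h.isEigenvalue_iff hp l).2 hl)).trans_lt (lt_of_le_of_ne hl0 ?_)
    rintro rfl
    exact hF.ne hl

end LowestEigenvalue

end VibratingString

theorem theorem3p3 (p : ℝ → ℝ) (hp : VibratingString.IsDensity p) (α β : ℝ)
    (hα : α ∈ Set.Ioc 0 Real.pi) (hβ : β ∈ Set.Ico 0 Real.pi) :
    -- `λ₀` is the lowest eigenvalue: it is an eigenvalue, and every eigenvalue is real and `≥ λ₀`
    (VibratingString.IsEigenvalue p α β (VibratingString.lowestEigenvalue p α β : ℂ) ∧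
      ∀ μ : ℂ, VibratingString.IsEigenvalue p α β μ →
        μ.im = 0 ∧ VibratingString.lowestEigenvalue p α β ≤ μ.re) ∧
    -- its sign
    (VibratingString.lowestEigenvalue p α β = 0 ↔ VibratingString.OnCurve α β) ∧
    (0 < VibratingString.lowestEigenvalue p α β ↔ VibratingString.InPositiveRegion α β) ∧
    (VibratingString.lowestEigenvalue p α β < 0 ↔
      ¬ VibratingString.OnCurve α β ∧ ¬ VibratingString.InPositiveRegion α β) := by
  have hleast := VibratingString.isLeast_lowestEigenvalue hp hα hβ
  refine ⟨⟨hleast.1, fun μ hμ => ?_⟩, ?_⟩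
  · have him := hμ.im_eq_zero hp
    have hre : ((μ.re : ℝ) : ℂ) = μ := Complex.ext (by simp) (by simp [him])
    exact ⟨him, hleast.2 (show VibratingString.IsEigenvalue p α β (μ.re : ℂ) from hre ▸ hμ)⟩
  · rw [VibratingString.onCurve_iff hα hβ, VibratingString.inPositiveRegion_iff hα hβ]
    have hzero := VibratingString.lowestEigenvalue_eq_zero hp hα hβ
    have hpos := VibratingString.lowestEigenvalue_pos hp hα hβ
    have hneg := VibratingString.lowestEigenvalue_neg hp hα hβ
    set D := (Real.sin α - Real.cos α) * Real.cos β - Real.cos α * Real.sin β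
    -- The cases are exhaustive and exclusive, so the three one-way implications yield all the
    -- equivalences.
    rcases lt_or_ge (Real.sin α) (Real.cos α) with hs | hs
    · have h1 := hneg (Or.inl hs)
      have h2 := hs.not_ge
      simp [h1, h1.ne, h1.le, h2]
    · rcases lt_trichotomy D 0 with hD | hD | hD
      · have h1 := hneg (Or.inr hD)
        simp [h1, h1.ne, h1.not_gt, hD.ne, hD.not_gt]
      · simp [hzero hs hD, hD, hs]
      · have h1 := hpos hs hD
        simp [h1, h1.ne', h1.le, hD, hD.ne', hs]
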